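/- Let $r,c\ge 2$ be integers. Write $[x,y]=x^{-1}y^{-1}xy$, let $\Gamma_1(G)=G$, $\Gamma_{i+1}(G)=[\Gamma_i(G),G]$ be the lower central series of a group $G$, and let $N_{r,c}(\mathbb Z)=F(r)/\Gamma_{c+1}(F(r))$, where $F(r)$ is the free group of rank $r$. A *Hall basic sequence* of $G=N_{r,c}(\mathbb Z)$ is a tuple $\mathbf u=(u_{11},\dots,u_{1n_1},u_{21},\dots,u_{2n_2},\dots,u_{c1},\dots,u_{cn_c})$ of elements of $G$ such that each $u_{ij}$ is a commutator of weight $i$ in $u_{11},\dots,u_{1n_1}$ and, for each $1\le i\le c$, the elements $u_{i1}\Gamma_{i+1}(G),\dots,u_{in_i}\Gamma_{i+1}(G)$ freely generate the abelian group $\Gamma_i(G)/\Gamma_{i+1}(G)$; in particular $n_1=r$. Every $g\in G$ is then uniquely of the form $g=\mathbf u^{\mathbf a}=u_{11}^{a_{11}}u_{12}^{a_{12}}\cdots u_{cn_c}^{a_{cn_c}}$ with integers $a_{ij}$. By a theorem of P. Hall, there are unique polynomials $p_{ij}(\mathbf x,\mathbf y)$, each an integer combination of products of binomial coefficients $\binom{x_{kl}}{m}$,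 $\binom{y_{kl}}{m}$, such that $\mathbf u^{\mathbf a}\mathbf u^{\mathbf b}=\mathbf u^{p(\mathbf a,\mathbf b)}$ for all integer tuples $\mathbf a,\mathbf b$. A *binomial domain* is an integral domain $R$ of characteristic zero such that for all $a\in R$ and all integers $k\ge 1$ the equation $a(a-1)\cdots(a-k+1)=k!\,x$ has a unique solution $x=\binom ak$ in $R$. For a binomial domain $R$, the group $N_{r,c}(R)$ is the set of formal products $\mathbf u^{\mathbf a}$, with $a_{ij}\in R$, with the multiplication $\mathbf u^{\mathbf a}\mathbf u^{\mathbf b}=\mathbf u^{p(\mathbf a,\mathbf b)}$; up to isomorphism it does not depend on $\mathbf u$. Write $R^+$ for the additive group of $R$. A symmetric 2-cocycle $f:B\times B\to A$, for abelian groups $A$ and $B$, is a map with $f(x+y,z)+f(x,y)=f(x,y+z)+f(y,z)$, $f(0,x)=f(x,0)=0$ and $f(x,y)=f(y,x)$ for all $x,y,z\in B$. Given symmetric 2-cocycles $f^1,\dots,f^r:R^+\times R^+\to\bigoplus_{j=1}^{n_c}R^+$, $f^k=(f^k_1,\dots,f^k_{n_c})$, the group $N_{r,c}(R,\bar f)$,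 $\bar f=(f^1,\dots,f^r)$, is the set of formal products $\mathbf u^{\mathbf a}$, with $a_{ij}\in R$, with the multiplication $\mathbf u^{\mathbf a}\mathbf u^{\mathbf b}=\mathbf u^{\mathbf d}$, where $$d_{ij}=p_{ij}(\mathbf a,\mathbf b)\quad(1\le i\le c-1),\qquad d_{cj}=p_{cj}(\mathbf a,\mathbf b)+\sum_{k=1}^r f^k_j(a_{1k},b_{1k}).$$ **Theorem.** Let $R$ and $S$ be binomial domains, let $\mathbf u$ and $\mathbf v$ be Hall basic sequences of $N_{r,c}(\mathbb Z)$, and let $f^1,\dots,f^r:R^+\times R^+\to\bigoplus_{j=1}^{n_c}R^+$ be symmetric 2-cocycles. Suppose that there is a group isomorphism $N_{r,c}(R,\bar f)\cong N_{r,c}(S)$, where the first group is formed with $\mathbf u$ and the second with $\mathbf v$. Then each $f^j$, $1\le j\le r$, is a 2-coboundary: there is a map $\psi_j:R\to\bigoplus_{i=1}^{n_c}R^+$ with $\psi_j(x+y)=f^j(x,y)+\psi_j(x)+\psi_j(y)$ for all $x,y\in R$. -/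

import Mathlib

noncomputable section

/-- `N_{r,c}(ℤ)`: the free nilpotent group of rank `r` and class `c`, that is
`F(r) / Γ_{c+1}(F(r))`. Mathlib counts the lower central series from `0`, so that
`Γ_{i+1}(G)` is `(⊤ : Subgroup G).lowerCentralSeries i`. -/
abbrev FreeNilpotentGroup (r c : ℕ) : Type :=
  FreeGroup (Fin r) ⧸ (⊤ : Subgroup (FreeGroup (Fin r))).lowerCentralSeries c

/-- `IsCommutatorOfWeight X w g`: the element `g` is a (bracketed) commutator of weight `w` in
elements of `X`, where `[x, y] = x⁻¹ y⁻¹ x y`. -/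
inductive IsCommutatorOfWeight {G : Type*} [Group G] (X : Set G) : ℕ → G → Prop
  | of {g : G} (hg : g ∈ X) : IsCommutatorOfWeight X 1 g
  | comm {v w : ℕ} {g h : G} (hg : IsCommutatorOfWeight X v g)
      (hh : IsCommutatorOfWeight X w h) :
      IsCommutatorOfWeight X (v + w) (g⁻¹ * h⁻¹ * g * h)

/-- A Hall basic sequence of `N_{r,c}(ℤ)`. The first index `i : Fin c` stands for the weight
`i + 1`; thus `u i j` is `u_{i+1,j+1}` and `n i` is `n_{i+1}` in the usual numbering. -/
structure HallBasicSequence (r c : ℕ) [NeZero c] where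
  /-- the number of terms of each weight; in weight one it is necessarily `r` -/
  n : Fin c → ℕ
  /-- the terms of the sequence -/
  u : (i : Fin c) → Fin (n i) → FreeNilpotentGroup r c
  /-- each term is a commutator, of the right weight, in the terms of weight one -/
  isCommutator : ∀ (i : Fin c) (j : Fin (n i)), IsCommutatorOfWeight (Set.range (u 0)) ((i : ℕ) + 1) (u i j)
  /-- the terms of weight `i + 1` lie in `Γ_{i+1}` -/
  mem : ∀ (i : Fin c) (j : Fin (n i)),
    u i j ∈ (⊤ : Subgroup (FreeNilpotentGroup r c)).lowerCentralSeries i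
  /-- the terms of weight `i + 1` generate `Γ_{i+1} / Γ_{i+2}` freely as an abelian group: each
  `x ∈ Γ_{i+1}` is congruent, modulo `Γ_{i+2}`, to a unique product of powers of these terms -/
  free : ∀ i : Fin c, ∀ x ∈ (⊤ : Subgroup (FreeNilpotentGroup r c)).lowerCentralSeries i,
    ∃! a : Fin (n i) → ℤ, x⁻¹ * (List.ofFn fun j => u i j ^ a j).prod ∈
      (⊤ : Subgroup (FreeNilpotentGroup r c)).lowerCentralSeries ((i : ℕ) + 1)

/-- Integer combinations of products of binomial coefficients `∏ s, (x_s choose m_s)` in the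
variables `x_s`, `s : σ`. -/
abbrev BinomialPolynomial (σ : Type*) : Type _ := (σ →₀ ℕ) →₀ ℤ

/-- The value of an integer combination of products of binomial coefficients at a point of a
binomial ring. -/
def BinomialPolynomial.eval {σ R : Type*} [CommRing R] [BinomialRing R]
    (p : BinomialPolynomial σ) (x : σ → R) : R :=
  p.sum fun m z => z • m.prod fun s k => Ring.choose (x s) k

namespace HallBasicSequence

variable {r c : ℕ} [NeZero c] (U : HallBasicSequence r c)

/-- The set of double indices `(i, j)` of the sequence. -/
abbrev Index : Type := Σ i : Fin c, Fin (U.n i)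

/-- The ordered product `u^a = u_{11}^{a_{11}} u_{12}^{a_{12}} ⋯ u_{c,n_c}^{a_{c,n_c}}`. -/
def normalForm (a : U.Index → ℤ) : FreeNilpotentGroup r c :=
  (List.ofFn fun i : Fin c => (List.ofFn fun j : Fin (U.n i) => U.u i j ^ a ⟨i, j⟩).prod).prod

/-- `p` is a family of canonical polynomials for the multiplication: `u^a u^b = u^{p(a,b)}`. -/
def IsCanonical (p : U.Index → BinomialPolynomial (U.Index ⊕ U.Index)) : Prop :=
  ∀ a b : U.Index → ℤ,
    U.normalForm a * U.normalForm b = U.normalForm fun x => (p x).eval (Sum.elim a b)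

/-- The canonical polynomials `p_{ij}` associated to the sequence: the family of polynomials
with `u^a u^b = u^{p(a,b)}` for all integer tuples `a` and `b`. (By a theorem of P. Hall there
is such a family; it is unique, since a polynomial is determined by its values at the integer
points.) -/
def canonicalPolynomials : U.Index → BinomialPolynomial (U.Index ⊕ U.Index) :=
  Classical.epsilon U.IsCanonical

/-- `N_{r,c}(R)`: the P. Hall `R`-completion of `N_{r,c}(ℤ)`. Its elements are the formal products
`u^a`, where `a` is a tuple of elements of the binomial ring `R`. -/
@[ext]
structure Completion (R : Type*) where
  /-- the tuple of exponents -/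
  exponents : U.Index → R

/-- The product `u^a u^b = u^d` of `N_{r,c}(R)`: `d = p(a,b)`. -/
instance (R : Type*) [CommRing R] [BinomialRing R] : Mul (U.Completion R) where
  mul g h := ⟨fun x => (U.canonicalPolynomials x).eval (Sum.elim g.exponents h.exponents)⟩

/-- `N_{r,c}(R, f¹, …, fʳ)`: the formal products `u^a`, with the product of `N_{r,c}(R)` deformed
by maps `f^k : R × R → R^{n_c}`, one for each term `u_{1k}` of weight one. Here `0 : Fin c` is the
index of weight `1` and `⊤ : Fin c` that of weight `c`. -/
@[ext]
structure Deformation {R : Type*} (f : Fin (U.n 0) → R → R → Fin (U.n ⊤) → R) where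
  /-- the tuple of exponents -/
  exponents : U.Index → R

/-- The product `u^a u^b = u^d` of `N_{r,c}(R, f¹, …, fʳ)`: `d_{ij} = p_{ij}(a,b)` for `i < c`, and
`d_{cj} = p_{cj}(a,b) + ∑ k, f^k_j(a_{1k}, b_{1k})`. -/
instance {R : Type*} [CommRing R] [BinomialRing R]
    (f : Fin (U.n 0) → R → R → Fin (U.n ⊤) → R) : Mul (U.Deformation f) where
  mul g h :=
    ⟨(fun x => (U.canonicalPolynomials x).eval (Sum.elim g.exponents h.exponents)) +
      ∑ j : Fin (U.n ⊤),
        Pi.single (⟨⊤, j⟩ : U.Index) (∑ k, f k (g.exponents ⟨0, k⟩) (h.exponents ⟨0, k⟩) j)⟩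

theorem Deformation.mul_exponents_of_ne {R : Type*} [CommRing R] [BinomialRing R]
    {f : Fin (U.n 0) → R → R → Fin (U.n ⊤) → R} (g h : U.Deformation f) (x : U.Index)
    (hx : x.1 ≠ ⊤) :
    (g * h).exponents x =
      (U.canonicalPolynomials x).eval (Sum.elim g.exponents h.exponents) := by
  have h0 : ∀ j : Fin (U.n ⊤), x ≠ ⟨⊤, j⟩ := fun j e => hx (by rw [e])
  change _ + (∑ j : Fin (U.n ⊤), Pi.single (⟨⊤, j⟩ : U.Index) _ : U.Index → R) x = _
  rw [Finset.sum_apply, Finset.sum_eq_zero, add_zero]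
  intro j _
  exact Pi.single_eq_of_ne (h0 j) _

theorem Deformation.mul_exponents_top {R : Type*} [CommRing R] [BinomialRing R]
    {f : Fin (U.n 0) → R → R → Fin (U.n ⊤) → R} (g h : U.Deformation f) (j : Fin (U.n ⊤)) :
    (g * h).exponents ⟨⊤, j⟩ =
      (U.canonicalPolynomials ⟨⊤, j⟩).eval (Sum.elim g.exponents h.exponents) +
        ∑ k, f k (g.exponents ⟨0, k⟩) (h.exponents ⟨0, k⟩) j := by
  change _ + (∑ j : Fin (U.n ⊤), Pi.single (⟨⊤, j⟩ : U.Index) _ : U.Index → R) _ = _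
  rw [Finset.sum_apply, Finset.sum_eq_single j, Pi.single_eq_same]
  · intro i _ hi
    refine Pi.single_eq_of_ne (fun e => hi ?_) _
    simpa using e.symm
  · simp

end HallBasicSequence

/-- Symmetric 2-cocycles `B × B → A` for abelian groups `B` and `A`, written additively. -/
structure IsSymmetricTwoCocycle {B A : Type*} [AddCommGroup B] [AddCommGroup A]
    (f : B → B → A) : Prop where
  cocycle : ∀ x y z, f (x + y) z + f x y = f x (y + z) + f y z
  zero_left : ∀ x, f 0 x = 0
  zero_right : ∀ x, f x 0 = 0
  symm : ∀ x y, f x y = f y x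

/-- 2-coboundaries `B × B → A` for abelian groups `B` and `A`, written additively. -/
def IsTwoCoboundary {B A : Type*} [AddCommGroup B] [AddCommGroup A] (f : B → B → A) : Prop :=
  ∃ ψ : B → A, ∀ x y, ψ (x + y) = f x y + ψ x + ψ y

end

/-!
The proof compares the two groups through a faithful linear model, the Magnus representation.

*The model.* Let `K` be a field of characteristic zero. Sending the `l`-th generator of the free
nilpotent group to `1 + (a linear form in noncommuting letters X_k) t`, where the linear form
records the coordinates of the generator with respect to the terms `u_{1k}`, gives a homomorphism
`magnus` into the units of the ring of power series in `t`, truncated beyond `t ^ c`, over the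
free associative algebra. As the ring is `t`-adically filtered, its unipotent elements have powers
with arbitrary exponents in a binomial ring (`TruncSeries.bpow`), so that a formal product `u^a`
has an image `magnusForm K a`. If `a` and `a'` agree in weights below `n + 1`, the images agree up
to `t ^ n`, and the difference of their coefficients of `t ^ (n + 1)` is a linear function of the
differences of the exponents of weight `n + 1` (`magnusForm_sub`). It is injective by the
Dynkin–Specht–Wever lemma (`vecMul_none_leading`): bracketing the letters of the leading
coefficient of an element of `Γ_{n+1}` from the left yields `n + 1` times its class in the graded
Lie ring. Hence `magnusForm K` is injective, and its inverse is polynomial in the coefficients.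

*Hall's polynomials.* Consequently the exponents of a product, or of a power, of formal products
are given by rational polynomials which take integer values at integer points, that is, by integer
combinations of products of binomial coefficients (`BinomialPolynomial.exists_eval_X_eq`). This
proves Hall's theorem, so that `canonicalPolynomials` has the defining property
(`exists_isCanonical`, `isCanonical_canonicalPolynomials`), and transfers it to every binomial
domain `R`: over the field of fractions `magnusForm` turns the product of `N_{r,c}(R)` into the
product of series (`magnusForm_canonicalPolynomials`). In the deformed group the product is
altered by a central factor, in degree `t ^ c` (`Deformation.embed_mul`), which makes it a group
in which commutators can be computed from their leading coefficients.

*Group-theoretic characterizations.* From the leading coefficients one reads off that the elements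
`x` without exponents of weight one are those with `[x, z, …, z] = 1` (`c - 1` times `z`) for all
`z` (`Deformation.weightOne_eq_zero_iff`), that `x` and `y` have proportional exponents of weight
one if and only if `[x, y, z, …, z] = 1` (`c - 2` times `z`) for all `z`
(`Deformation.weightOne_minors_iff`), and that an element without exponents of weight one which
commutes with `u_{1k}` has only exponents of weight `c`
(`Deformation.exponents_eq_zero_of_commute`).

*The conclusion.* An isomorphism `φ` onto `N_{r,c}(S)` therefore induces an additive bijection of
the exponents of weight one that respects proportionality. As there are at least two terms of
weight one, multiplication by `a ∈ R` is carried to multiplication by a scalar `μ a ∈ S`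
(`Deformation.exists_scalar`), with `μ` additive. In `N_{r,c}(S)` the element `h = φ (u_{1k})` has
powers `h ^ (μ a)`; pulled back along `φ` they form a homomorphism `σ` from the additive group of
`R` to the centralizer of `u_{1k}`, and `σ a = u_{1k}^a z_a` with `z_a` of weight `c`. Comparing
`σ (a + b)` with `σ a * σ b` shows that the exponents of `z_a` are a cochain with coboundary `f^k`
(`Deformation.isTwoCoboundary_of_section`).
-/

noncomputable section

/-! ### Truncated power series over a noncommutative ring -/

/-- The congruence on `A⟦t⟧` that identifies two series when their coefficients of degree at most
`c` agree. -/
def truncCon (A : Type*) [Ring A] (c : ℕ) : RingCon (PowerSeries A) where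
  r f g := ∀ n ≤ c, PowerSeries.coeff n f = PowerSeries.coeff n g
  iseqv := ⟨fun _ _ _ => rfl, fun h n hn => (h n hn).symm,
    fun h h' n hn => (h n hn).trans (h' n hn)⟩
  add' h h' n hn := by simp [h n hn, h' n hn]
  mul' h h' n hn := by
    rw [PowerSeries.coeff_mul, PowerSeries.coeff_mul]
    refine Finset.sum_congr rfl fun p hp => ?_
    have := Finset.HasAntidiagonal.mem_antidiagonal.1 hp
    rw [h _ (by omega), h' _ (by omega)]

/-- The ring `A⟦t⟧ / (t ^ (c + 1))`. -/
def TruncSeries (A : Type*) [Ring A] (c : ℕ) : Type _ := (truncCon A c).Quotient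

instance (A : Type*) [Ring A] (c : ℕ) : Ring (TruncSeries A c) :=
  inferInstanceAs (Ring (truncCon A c).Quotient)

instance (K A : Type*) [Ring A] [CommRing K] [Algebra K A] (c : ℕ) : Algebra K (TruncSeries A c) :=
  inferInstanceAs (Algebra K (truncCon A c).Quotient)

namespace TruncSeries

variable {A : Type*} [Ring A] {c : ℕ}

/-- The class of a power series. -/
def mk : PowerSeries A →+* TruncSeries A c := (truncCon A c).mk'

theorem mk_surjective : Function.Surjective (mk : PowerSeries A → TruncSeries A c) :=
  (truncCon A c).mk'_surjective

/-- The coefficient of `t ^ n`; it is `0` by convention when `n > c`. -/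
def coeff (n : ℕ) : TruncSeries A c →+ A where
  toFun := Quotient.lift (fun f => if n ≤ c then PowerSeries.coeff n f else 0) fun f g h => by
    by_cases hn : n ≤ c
    · simpa [hn] using h n hn
    · simp [hn]
  map_zero' := by
    change (if n ≤ c then PowerSeries.coeff n (0 : PowerSeries A) else 0) = 0
    simp
  map_add' x y := by
    induction x using Quotient.inductionOn
    induction y using Quotient.inductionOn
    rename_i f g
    change (if n ≤ c then PowerSeries.coeff n (f + g) else 0) =
      (if n ≤ c then PowerSeries.coeff n f else 0) + (if n ≤ c then PowerSeries.coeff n g else 0)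
    split_ifs <;> simp

theorem coeff_mk (n : ℕ) (f : PowerSeries A) :
    coeff n (mk f : TruncSeries A c) = if n ≤ c then PowerSeries.coeff n f else 0 := rfl

theorem coeff_of_lt {n : ℕ} (hn : c < n) (x : TruncSeries A c) : coeff n x = 0 := by
  obtain ⟨f, rfl⟩ := mk_surjective x
  rw [coeff_mk, if_neg (by omega)]

@[ext]
theorem ext {x y : TruncSeries A c} (h : ∀ n ≤ c, coeff n x = coeff n y) : x = y := by
  obtain ⟨f, rfl⟩ := mk_surjective x
  obtain ⟨g, rfl⟩ := mk_surjective y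
  refine (RingCon.eq _).2 fun n hn => ?_
  have := h n hn
  rwa [coeff_mk, coeff_mk, if_pos hn, if_pos hn] at this

theorem coeff_mul {n : ℕ} (hn : n ≤ c) (x y : TruncSeries A c) :
    coeff n (x * y) = ∑ p ∈ Finset.HasAntidiagonal.antidiagonal n, coeff p.1 x * coeff p.2 y := by
  obtain ⟨f, rfl⟩ := mk_surjective x
  obtain ⟨g, rfl⟩ := mk_surjective y
  rw [← map_mul, coeff_mk, if_pos hn, PowerSeries.coeff_mul]
  refine Finset.sum_congr rfl fun p hp => ?_
  have := Finset.HasAntidiagonal.mem_antidiagonal.1 hp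
  rw [coeff_mk, coeff_mk, if_pos (by omega), if_pos (by omega)]

theorem coeff_zero_one : coeff 0 (1 : TruncSeries A c) = 1 := by
  rw [← map_one mk, coeff_mk]
  simp

theorem coeff_smul {K : Type*} [CommRing K] [Algebra K A] (n : ℕ) (k : K) (x : TruncSeries A c) :
    coeff n (k • x) = k • coeff n x := by
  obtain ⟨f, rfl⟩ := mk_surjective x
  change coeff n (mk (k • f)) = _
  rw [coeff_mk, coeff_mk]
  split_ifs <;> simp

/-- The element `a t ^ n` of `A⟦t⟧ / (t ^ (c + 1))`. -/
def monomial (n : ℕ) (a : A) : TruncSeries A c := mk (PowerSeries.monomial n a)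

theorem coeff_monomial (m n : ℕ) (a : A) :
    coeff m (monomial n a : TruncSeries A c) = if m = n ∧ m ≤ c then a else 0 := by
  rw [monomial, coeff_mk, PowerSeries.coeff_monomial]
  split_ifs <;> first | rfl | omega

/-- The series divisible by `t ^ i`. -/
def filtration (i : ℕ) : AddSubgroup (TruncSeries A c) where
  carrier := {x | ∀ k < i, coeff k x = 0}
  zero_mem' k _ := map_zero _
  add_mem' hx hy k hk := by rw [map_add, hx k hk, hy k hk, add_zero]
  neg_mem' hx k hk := by rw [map_neg, hx k hk, neg_zero]

theorem filtration_anti {i j : ℕ} (h : i ≤ j) {x : TruncSeries A c} (hx : x ∈ filtration j) :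
    x ∈ filtration i := fun k hk => hx k (hk.trans_le h)

theorem mem_filtration_zero (x : TruncSeries A c) : x ∈ filtration 0 := fun k hk => by omega

theorem mem_filtration_succ {i : ℕ} {x : TruncSeries A c} :
    x ∈ filtration (i + 1) ↔ x ∈ filtration i ∧ coeff i x = 0 := by
  refine ⟨fun h => ⟨filtration_anti i.le_succ h, h i i.lt_succ_self⟩, fun h k hk => ?_⟩
  rcases Nat.lt_succ_iff_lt_or_eq.1 hk with h' | rfl
  exacts [h.1 k h', h.2]

theorem eq_zero_of_mem {i : ℕ} (hi : c < i) {x : TruncSeries A c} (hx : x ∈ filtration i) :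
    x = 0 := by
  ext n hn
  rw [hx n (by omega), map_zero]

theorem mul_mem {i j : ℕ} {x y : TruncSeries A c} (hx : x ∈ filtration i)
    (hy : y ∈ filtration j) : x * y ∈ filtration (i + j) := by
  intro k hk
  by_cases hc : k ≤ c
  · rw [coeff_mul hc]
    refine Finset.sum_eq_zero fun p hp => ?_
    have := Finset.HasAntidiagonal.mem_antidiagonal.1 hp
    rcases lt_or_ge p.1 i with h | h
    · rw [hx _ h, zero_mul]
    · rw [hy _ (by omega), mul_zero]
  · exact coeff_of_lt (by omega) _

theorem mul_mem_left {j : ℕ} (x : TruncSeries A c) {y : TruncSeries A c}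
    (hy : y ∈ filtration j) : x * y ∈ filtration j := by
  simpa using mul_mem (mem_filtration_zero x) hy

theorem mul_mem_right {j : ℕ} {x : TruncSeries A c} (y : TruncSeries A c)
    (hx : x ∈ filtration j) : x * y ∈ filtration j := by
  simpa using mul_mem hx (mem_filtration_zero y)

theorem smul_mem {K : Type*} [CommRing K] [Algebra K A] {i : ℕ} (k : K) {x : TruncSeries A c}
    (hx : x ∈ filtration i) : k • x ∈ filtration i := fun n hn => by
  rw [coeff_smul, hx n hn, smul_zero]

/-- The lowest coefficients multiply. -/
theorem coeff_mul_of_mem {i j : ℕ} (hc : i + j ≤ c) {x y : TruncSeries A c}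
    (hx : x ∈ filtration i) (hy : y ∈ filtration j) :
    coeff (i + j) (x * y) = coeff i x * coeff j y := by
  rw [coeff_mul hc, Finset.sum_eq_single (i, j)]
  · intro p hp hne
    have := Finset.HasAntidiagonal.mem_antidiagonal.1 hp
    rcases lt_trichotomy p.1 i with h | h | h
    · rw [hx _ h, zero_mul]
    · exact absurd (Prod.ext h (by simp; omega)) hne
    · rw [hy _ (by omega), mul_zero]
  · simp

theorem pow_mem {x : TruncSeries A c} (hx : x ∈ filtration 1) (n : ℕ) : x ^ n ∈ filtration n := by
  induction n with
  | zero => exact mem_filtration_zero _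
  | succ n ih => rw [pow_succ]; exact mul_mem ih hx

theorem pow_eq_zero {x : TruncSeries A c} (hx : x ∈ filtration 1) {n : ℕ} (hn : c < n) :
    x ^ n = 0 := eq_zero_of_mem hn (pow_mem hx n)

theorem coeff_zero_of_sub_one_mem {x : TruncSeries A c} (hx : x - 1 ∈ filtration 1) :
    coeff 0 x = 1 := by
  have := hx 0 one_pos
  rw [map_sub, coeff_zero_one] at this
  exact sub_eq_zero.1 this

/-- Multiplication by a series with constant term `1` does not change the lowest coefficient. -/
theorem coeff_mul_unipotent {i : ℕ} {x y : TruncSeries A c} (hx : x ∈ filtration i)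
    (hy : y - 1 ∈ filtration 1) : coeff i (x * y) = coeff i x := by
  by_cases hc : i ≤ c
  · have := coeff_mul_of_mem (j := 0) hc hx (mem_filtration_zero y)
    rwa [add_zero, coeff_zero_of_sub_one_mem hy, mul_one] at this
  · rw [coeff_of_lt (by omega), coeff_of_lt (by omega)]

theorem coeff_unipotent_mul {i : ℕ} {x y : TruncSeries A c} (hx : x ∈ filtration i)
    (hy : y - 1 ∈ filtration 1) : coeff i (y * x) = coeff i x := by
  by_cases hc : i ≤ c
  · have := coeff_mul_of_mem (i := 0) (by omega) (mem_filtration_zero y) hx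
    rwa [zero_add, coeff_zero_of_sub_one_mem hy, one_mul] at this
  · rw [coeff_of_lt (by omega), coeff_of_lt (by omega)]

theorem mul_sub_one_mem {i : ℕ} {x y : TruncSeries A c} (hx : x - 1 ∈ filtration i)
    (hy : y - 1 ∈ filtration i) : x * y - 1 ∈ filtration i := by
  have : x * y - 1 = (x - 1) * y + (y - 1) := by noncomm_ring
  rw [this]
  exact add_mem (mul_mem_right y hx) hy

theorem isUnit_of_sub_one_mem {x : TruncSeries A c} (hx : x - 1 ∈ filtration 1) : IsUnit x := by
  have : IsNilpotent (x - 1) := ⟨c + 1, pow_eq_zero hx c.lt_succ_self⟩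
  simpa using this.isUnit_one_add

/-- If `C h g = g h` with `g ≡ 1 mod t ^ i` and `h ≡ 1 mod t ^ j`, then the group commutator
`C = [g, h]` is `≡ 1 mod t ^ (i + j)`. -/
theorem commutator_sub_one_mem {i j : ℕ} {g h C : TruncSeries A c}
    (hg : g - 1 ∈ filtration i) (hh : h - 1 ∈ filtration j) (hu : IsUnit (h * g))
    (hC : C * (h * g) = g * h) : C - 1 ∈ filtration (i + j) := by
  obtain ⟨u, hu⟩ := hu
  have : C - 1 = ((g - 1) * (h - 1) - (h - 1) * (g - 1)) * ↑u⁻¹ := by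
    rw [Units.eq_mul_inv_iff_mul_eq, hu, sub_mul, hC]
    noncomm_ring
  rw [this]
  refine mul_mem_right _ (sub_mem (mul_mem hg hh) ?_)
  rw [add_comm]
  exact mul_mem hh hg

/-- The leading coefficient of a group commutator is the commutator of the leading
coefficients. -/
theorem coeff_commutator {i j : ℕ} (hc : i + j ≤ c) {g h C : TruncSeries A c}
    (hg : g - 1 ∈ filtration i) (hh : h - 1 ∈ filtration j) (hu : h * g - 1 ∈ filtration 1)
    (hC : C * (h * g) = g * h) :
    coeff (i + j) (C - 1) =
      coeff i (g - 1) * coeff j (h - 1) - coeff j (h - 1) * coeff i (g - 1) := by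
  have hm := commutator_sub_one_mem hg hh (isUnit_of_sub_one_mem hu) hC
  rw [← coeff_mul_unipotent hm hu, sub_mul, hC, ← coeff_mul_of_mem hc hg hh, add_comm i j,
    ← coeff_mul_of_mem (add_comm i j ▸ hc) hh hg, ← map_sub]
  congr 1
  noncomm_ring

section Map

variable {A' : Type*} [Ring A'] (φ : A →+* A')

/-- Apply a ring homomorphism to all coefficients. -/
def map : TruncSeries A c →+* TruncSeries A' c :=
  (truncCon A c).lift ((truncCon A' c).mk'.comp (PowerSeries.map φ)) fun f g h => by
    refine (RingCon.eq _).2 fun n hn => ?_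
    simp [h n hn]

theorem coeff_map (n : ℕ) (x : TruncSeries A c) : coeff n (map φ x) = φ (coeff n x) := by
  obtain ⟨f, rfl⟩ := mk_surjective x
  change coeff n (mk (PowerSeries.map φ f)) = _
  rw [coeff_mk, coeff_mk]
  split_ifs <;> simp

end Map

section Pow

variable {K : Type*} [CommRing K] [BinomialRing K] [Algebra K A]

/-- The power `g ^ l = ∑ m, (l choose m) (g - 1) ^ m` with exponent in a binomial ring, for a series
`g` with constant term `1`. -/
def bpow (g : TruncSeries A c) (l : K) : TruncSeries A c :=
  ∑ m ∈ Finset.range (c + 1), Ring.choose l m • (g - 1) ^ m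

theorem bpow_zero (g : TruncSeries A c) : bpow g (0 : K) = 1 := by
  rw [bpow, Finset.sum_eq_single 0]
  · simp
  · intro m _ hm
    rw [Ring.choose_zero_pos K (Nat.pos_of_ne_zero hm), zero_smul]
  · simp

theorem bpow_add {g : TruncSeries A c} (hg : g - 1 ∈ filtration 1) (l m : K) :
    bpow g (l + m) = bpow g l * bpow g m := by
  have key : ∀ N, c < N → ∀ l : K,
      bpow g l = ∑ m ∈ Finset.range N, Ring.choose l m • (g - 1) ^ m := by
    intro N hN l
    refine Finset.sum_subset (by simpa using hN) fun m _ hm => ?_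
    rw [pow_eq_zero hg (by simpa using hm), smul_zero]
  have e : bpow g l * bpow g m = ∑ p ∈ Finset.range (c + 1) ×ˢ Finset.range (c + 1),
      (Ring.choose l p.1 * Ring.choose m p.2) • (g - 1) ^ (p.1 + p.2) := by
    rw [bpow, bpow, Finset.sum_mul_sum, ← Finset.sum_product']
    refine Finset.sum_congr rfl fun p _ => ?_
    rw [smul_mul_smul_comm, pow_add]
  rw [e, bpow]
  have e2 : ∀ k ∈ Finset.range (c + 1), Ring.choose (l + m) k • (g - 1) ^ k =
      ∑ p ∈ (Finset.range (c + 1) ×ˢ Finset.range (c + 1)) with p.1 + p.2 = k,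
        (Ring.choose l p.1 * Ring.choose m p.2) • (g - 1) ^ (p.1 + p.2) := by
    intro k hk
    rw [Ring.add_choose_eq k (Commute.all _ _), Finset.sum_smul]
    refine Finset.sum_congr ?_ fun p hp => ?_
    · ext p
      simp only [Finset.HasAntidiagonal.mem_antidiagonal, Finset.mem_filter,
        Finset.mem_product, Finset.mem_range] at hk ⊢
      omega
    · rw [(Finset.mem_filter.1 hp).2]
  rw [Finset.sum_congr rfl e2, Finset.sum_fiberwise_eq_sum_filter]
  refine Finset.sum_subset (Finset.filter_subset _ _) fun p _ hp => ?_
  have : c < p.1 + p.2 := by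
    by_contra h
    simp_all
  rw [pow_eq_zero hg this, smul_zero]

theorem bpow_one (hc : 1 ≤ c) (g : TruncSeries A c) : bpow g (1 : K) = g := by
  obtain ⟨d, rfl⟩ : ∃ d, c = d + 1 := ⟨c - 1, by omega⟩
  rw [bpow, Finset.sum_range_succ', Finset.sum_range_succ', Finset.sum_eq_zero]
  · simp
  · intro m _
    have : Ring.choose (1 : K) (m + 1 + 1) = 0 := by
      have := Ring.choose_natCast (R := K) 1 (m + 1 + 1)
      rwa [Nat.cast_one, Nat.choose_eq_zero_of_lt (by omega), Nat.cast_zero] at this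
    rw [this, zero_smul]

theorem bpow_sub_one (g : TruncSeries A c) (l : K) :
    bpow g l - 1 = ∑ m ∈ Finset.range c, Ring.choose l (m + 1) • (g - 1) ^ (m + 1) := by
  rw [bpow, Finset.sum_range_succ']
  simp

theorem bpow_sub_one_mem {i : ℕ} {g : TruncSeries A c} (hg : g - 1 ∈ filtration i)
    (l : K) : bpow g l - 1 ∈ filtration i := by
  rw [bpow_sub_one]
  refine sum_mem fun m _ => smul_mem _ ?_
  rw [pow_succ]
  exact mul_mem_left _ hg

theorem coeff_bpow_sub_one {i : ℕ} (hi : 1 ≤ i) (hc : i ≤ c) {g : TruncSeries A c}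
    (hg : g - 1 ∈ filtration i) (l : K) :
    coeff i (bpow g l - 1) = l • coeff i (g - 1) := by
  obtain ⟨d, rfl⟩ : ∃ d, c = d + 1 := ⟨c - 1, by omega⟩
  rw [bpow_sub_one, Finset.sum_range_succ', map_add, map_sum, Finset.sum_eq_zero]
  · simp [coeff_smul]
  · intro m _
    have h2 : (g - 1) ^ (m + 1 + 1) ∈ filtration (i + i) := by
      rw [pow_succ, pow_succ, mul_assoc]
      exact mul_mem_left _ (mul_mem hg hg)
    rw [coeff_smul, h2 i (by omega), smul_zero]

theorem bpow_intCast (hc : 1 ≤ c) (g : (TruncSeries A c)ˣ)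
    (hg : (g : TruncSeries A c) - 1 ∈ filtration 1) (n : ℤ) :
    bpow (g : TruncSeries A c) (n : K) = ((g ^ n : (TruncSeries A c)ˣ) : TruncSeries A c) := by
  induction n with
  | zero => simp [bpow_zero]
  | succ n ih =>
    push_cast at ih ⊢
    rw [bpow_add hg, ih, bpow_one hc, zpow_add_one, Units.val_mul]
  | pred n ih =>
    have h : bpow (g : TruncSeries A c) (((-(n : ℤ) - 1 : ℤ)) : K) * g =
        ((g ^ (-(n : ℤ) - 1) : (TruncSeries A c)ˣ) : TruncSeries A c) * g := by
      rw [← Units.val_mul, ← zpow_add_one, sub_add_cancel, ← ih]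
      nth_rw 2 [← bpow_one (K := K) hc (g : TruncSeries A c)]
      rw [← bpow_add hg]
      push_cast
      ring_nf
    exact (Units.mul_left_inj g).1 h

theorem map_bpow {K' A' : Type*} [CommRing K'] [BinomialRing K'] [Ring A'] [Algebra K' A']
    (σ : K →+* K') (φ : A →+* A') (h : ∀ (k : K) (a : A), φ (k • a) = σ k • φ a)
    (g : TruncSeries A c) (l : K) : map φ (bpow g l) = bpow (map φ g) (σ l) := by
  have h2 : ∀ (k : K) (x : TruncSeries A c), map φ (k • x) = σ k • map φ x := by
    intro k x
    ext n hn
    rw [coeff_map, coeff_smul, coeff_smul, coeff_map, h]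
  rw [bpow, bpow, map_sum]
  refine Finset.sum_congr rfl fun m _ => ?_
  rw [h2, map_pow, map_sub, map_one, Ring.map_choose]

end Pow

/-- If the entries of two products of series with constant term `1` agree up to order `m`, so do
the products, and the difference at order `m` is the sum of the differences of the entries. -/
theorem prod_ofFn_sub {n m : ℕ} (W W' : Fin n → TruncSeries A c)
    (h : ∀ i, W i - 1 ∈ filtration 1) (h' : ∀ i, W' i - 1 ∈ filtration 1)
    (hd : ∀ i, W i - W' i ∈ filtration m) :
    (List.ofFn W).prod - 1 ∈ filtration 1 ∧
    (List.ofFn W).prod - (List.ofFn W').prod ∈ filtration m ∧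
      coeff m ((List.ofFn W).prod - (List.ofFn W').prod) = ∑ i, coeff m (W i - W' i) := by
  induction n with
  | zero => simp [zero_mem]
  | succ n ih =>
    obtain ⟨h1, h2, h3⟩ := ih (fun i => W i.succ) (fun i => W' i.succ) (fun i => h _)
      (fun i => h' _) fun i => hd _
    rw [List.ofFn_succ, List.ofFn_succ, List.prod_cons, List.prod_cons, Fin.sum_univ_succ, ← h3]
    have e : ∀ a b a' b' : TruncSeries A c,
        a * b - a' * b' = (a - a') * b + a' * (b - b') := by intros; noncomm_ring
    refine ⟨mul_sub_one_mem (h 0) h1, ?_, ?_⟩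
    · rw [e]
      exact add_mem (mul_mem_right _ (hd 0)) (mul_mem_left _ h2)
    · rw [e, map_add, coeff_mul_unipotent (hd 0) h1, coeff_unipotent_mul h2 (h' 0)]

end TruncSeries

/-! ### Commutators in the lower central series -/

/-- The lower central series of a group, counted from `0`. -/
abbrev lcs (G : Type*) [Group G] (i : ℕ) : Subgroup G := (⊤ : Subgroup G).lowerCentralSeries i

open scoped commutatorElement

section LowerCentralSeries

variable {G : Type*} [Group G]

theorem commutator_commutator_le_of_rotate {H₁ H₂ H₃ N : Subgroup G} [N.Normal]
    (h1 : ⁅⁅H₂, H₃⁆, H₁⁆ ≤ N) (h2 : ⁅⁅H₃, H₁⁆, H₂⁆ ≤ N) : ⁅⁅H₁, H₂⁆, H₃⁆ ≤ N := by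
  have key : ∀ H : Subgroup G, H ≤ N ↔ H.map (QuotientGroup.mk' N) = ⊥ := fun H => by
    rw [Subgroup.map_eq_bot_iff, QuotientGroup.ker_mk']
  rw [key, Subgroup.map_commutator, Subgroup.map_commutator] at *
  exact Subgroup.commutator_commutator_eq_bot_of_rotate h1 h2

theorem commutator_lcs_le (i j : ℕ) : ⁅lcs G i, lcs G j⁆ ≤ lcs G (i + j + 1) := by
  induction j generalizing i with
  | zero => exact le_rfl
  | succ j ih =>
    rw [Subgroup.commutator_comm]
    refine commutator_commutator_le_of_rotate ?_ ?_
    · rw [Subgroup.commutator_comm ⊤]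
      exact (ih (i + 1)).trans (le_of_eq (by congr 1; omega))
    · exact (Subgroup.commutator_mono (ih i) le_rfl).trans (le_of_eq rfl)

theorem commutator_mem_lcs {i j n : ℕ} (hn : n = i + j + 1) {x y : G} (hx : x ∈ lcs G i)
    (hy : y ∈ lcs G j) : ⁅x, y⁆ ∈ lcs G n :=
  hn ▸ commutator_lcs_le i j (Subgroup.commutator_mem_commutator hx hy)

theorem lcs_anti {i j : ℕ} (h : i ≤ j) {x : G} (hx : x ∈ lcs G j) : x ∈ lcs G i :=
  Subgroup.lowerCentralSeries_antitone _ h hx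

theorem conj_mem_lcs {n : ℕ} {x : G} (hx : x ∈ lcs G n) (g : G) : g * x * g⁻¹ ∈ lcs G n :=
  (inferInstance : (lcs G n).Normal).conj_mem x hx g

theorem ofFn_prod_zpow_add {n : ℕ} (w : Fin n → G) (hw : ∀ i j, Commute (w i) (w j))
    (a b : Fin n → ℤ) :
    (List.ofFn fun j => w j ^ (a + b) j).prod =
      (List.ofFn fun j => w j ^ a j).prod * (List.ofFn fun j => w j ^ b j).prod := by
  induction n with
  | zero => simp
  | succ n ih =>
    have h := ih (fun i => w i.succ) (fun i j => hw _ _) (fun i => a i.succ) (fun i => b i.succ)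
    have hc : Commute (w 0 ^ b 0) (List.ofFn fun j : Fin n => w j.succ ^ a j.succ).prod := by
      refine Commute.list_prod_right _ _ fun x hx => ?_
      obtain ⟨j, rfl⟩ := (List.mem_ofFn' _ _).1 hx
      exact ((hw _ _).zpow_left _).zpow_right _
    simp only [List.ofFn_succ, List.prod_cons, Pi.add_apply] at h ⊢
    rw [h, zpow_add, mul_assoc, ← mul_assoc (w 0 ^ b 0), hc.eq]
    simp only [mul_assoc]

end LowerCentralSeries

theorem lcs_freeNilpotentGroup (r c : ℕ) : lcs (FreeNilpotentGroup r c) c = ⊥ := by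
  have h := Subgroup.map_lowerCentralSeries (⊤ : Subgroup (FreeGroup (Fin r)))
    (QuotientGroup.mk' ((⊤ : Subgroup (FreeGroup (Fin r))).lowerCentralSeries c)) c
  rw [Subgroup.map_top_of_surjective _ (QuotientGroup.mk'_surjective _)] at h
  rw [lcs, ← h, Subgroup.map_eq_bot_iff, QuotientGroup.ker_mk']

theorem eq_one_of_mem_lcs {r c n : ℕ} (hn : c ≤ n) {x : FreeNilpotentGroup r c}
    (hx : x ∈ lcs _ n) : x = 1 := by
  have := lcs_anti hn hx
  rwa [lcs_freeNilpotentGroup, Subgroup.mem_bot] at this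

namespace HallBasicSequence

variable {r c : ℕ} [NeZero c] (U : HallBasicSequence r c)

/-! ### Coordinates on the factors of the lower central series -/

open Classical in
/-- The coordinates of an element of `Γ_{i+1}` modulo `Γ_{i+2}`, relative to the terms of
weight `i + 1`. -/
def coord (i : Fin c) (x : FreeNilpotentGroup r c) : Fin (U.n i) → ℤ :=
  if h : x ∈ lcs _ i then (U.free i x h).choose else 0

variable {U}

theorem coord_spec {i : Fin c} {x : FreeNilpotentGroup r c} (h : x ∈ lcs _ i) :
    x⁻¹ * (List.ofFn fun j => U.u i j ^ U.coord i x j).prod ∈ lcs _ (i + 1) := by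
  rw [coord, dif_pos h]
  exact (U.free i x h).choose_spec.1

theorem coord_eq {i : Fin c} {x : FreeNilpotentGroup r c} (h : x ∈ lcs _ i) {a : Fin (U.n i) → ℤ}
    (ha : x⁻¹ * (List.ofFn fun j => U.u i j ^ a j).prod ∈ lcs _ (i + 1)) : U.coord i x = a :=
  (U.free i x h).unique (coord_spec h) ha

theorem coord_mul {i : Fin c} {x y : FreeNilpotentGroup r c} (hx : x ∈ lcs _ i) (hy : y ∈ lcs _ i) :
    U.coord i (x * y) = U.coord i x + U.coord i y := by
  refine coord_eq (mul_mem hx hy) ?_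
  have hx' := coord_spec (U := U) hx
  have hy' := coord_spec (U := U) hy
  rw [← QuotientGroup.eq] at hx' hy' ⊢
  rw [QuotientGroup.mk_mul, hx', hy', ← QuotientGroup.mk'_apply, ← QuotientGroup.mk'_apply,
    ← QuotientGroup.mk'_apply, map_list_prod, map_list_prod, map_list_prod]
  simp only [List.map_ofFn, Function.comp_def, map_zpow]
  refine (ofFn_prod_zpow_add (fun j => QuotientGroup.mk' (lcs _ (i + 1)) (U.u i j))
    (fun j k => ?_) _ _).symm
  rw [commute_iff_eq, ← map_mul, ← map_mul, QuotientGroup.mk'_apply, QuotientGroup.mk'_apply,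
    QuotientGroup.eq]
  have h := commutator_mem_lcs (n := i + 1 + i) (by omega) (inv_mem (U.mem i k))
    (inv_mem (U.mem i j))
  have e : (U.u i j * U.u i k)⁻¹ * (U.u i k * U.u i j) = ⁅(U.u i k)⁻¹, (U.u i j)⁻¹⁆ := by
    rw [commutatorElement_def]; group
  rw [e]
  exact lcs_anti (by omega) h

theorem coord_of_mem_succ {i : Fin c} {x : FreeNilpotentGroup r c} (hx : x ∈ lcs _ (i + 1)) :
    U.coord i x = 0 :=
  coord_eq (lcs_anti (Nat.le_succ _) hx) (by simpa [List.ofFn_const] using hx)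

theorem coord_u (i : Fin c) (j : Fin (U.n i)) : U.coord i (U.u i j) = Pi.single j 1 := by
  refine coord_eq (U.mem i j) ?_
  have : (List.ofFn fun k => U.u i k ^ (Pi.single j 1 : Fin (U.n i) → ℤ) k).prod = U.u i j := by
    have : ∀ (n : ℕ) (w : Fin n → FreeNilpotentGroup r c) (j : Fin n),
        (List.ofFn fun k => w k ^ (Pi.single j 1 : Fin n → ℤ) k).prod = w j := by
      intro n
      induction n with
      | zero => exact fun _ j => j.elim0
      | succ n ih =>
        intro w j
        rw [List.ofFn_succ, List.prod_cons]
        refine Fin.cases ?_ (fun j => ?_) j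
        · simp [Fin.succ_ne_zero]
        · have := ih (fun k => w k.succ) j
          simpa [Pi.single_apply, (Fin.succ_ne_zero _).symm] using this
    exact this _ _ _
  rw [this, inv_mul_cancel]
  exact one_mem _

variable (U)

/-- The class of an element of `Γ_{n+1}` in `Γ_{n+1} / Γ_{n+2}`, as a vector indexed by all the
terms of the sequence, supported on the terms of weight `n + 1` (and zero if `n ≥ c`). -/
def gradedClass (n : ℕ) (x : FreeNilpotentGroup r c) : U.Index → ℤ :=
  fun s => if (s.1 : ℕ) = n then U.coord s.1 x s.2 else 0

variable {U}

theorem gradedClass_mul {n : ℕ} {x y : FreeNilpotentGroup r c} (hx : x ∈ lcs _ n)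
    (hy : y ∈ lcs _ n) :
    U.gradedClass n (x * y) = U.gradedClass n x + U.gradedClass n y := by
  ext s
  by_cases h : (s.1 : ℕ) = n
  · subst h
    simp [gradedClass, coord_mul hx hy]
  · simp [gradedClass, h]

theorem gradedClass_of_mem_succ {n : ℕ} {x : FreeNilpotentGroup r c} (hx : x ∈ lcs _ (n + 1)) :
    U.gradedClass n x = 0 := by
  ext s
  by_cases h : (s.1 : ℕ) = n
  · subst h
    simp [gradedClass, coord_of_mem_succ hx]
  · simp [gradedClass, h]

theorem gradedClass_one (n : ℕ) : U.gradedClass n 1 = 0 := gradedClass_of_mem_succ (one_mem _)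

theorem gradedClass_inv {n : ℕ} {x : FreeNilpotentGroup r c} (hx : x ∈ lcs _ n) :
    U.gradedClass n x⁻¹ = - U.gradedClass n x := by
  rw [eq_neg_iff_add_eq_zero, ← gradedClass_mul (inv_mem hx) hx, inv_mul_cancel, gradedClass_one]

theorem gradedClass_u (s : U.Index) : U.gradedClass s.1 (U.u s.1 s.2) = Pi.single s 1 := by
  ext ⟨i, j⟩
  obtain ⟨k, l⟩ := s
  by_cases h : i = k
  · subst h
    by_cases hj : j = l
    · subst hj
      simp [gradedClass, coord_u]
    · rw [Pi.single_eq_of_ne (by simpa using hj)]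
      simp [gradedClass, coord_u, hj]
  · rw [Pi.single_eq_of_ne (fun e => h (congrArg Sigma.fst e))]
    simp [gradedClass, Fin.val_inj, h]

theorem gradedClass_conj {n : ℕ} {x : FreeNilpotentGroup r c} (hx : x ∈ lcs _ n)
    (g : FreeNilpotentGroup r c) :
    U.gradedClass n (g * x * g⁻¹) = U.gradedClass n x := by
  have h : ⁅g, x⁆ ∈ lcs _ (n + 1) := commutator_mem_lcs (i := 0) (by omega) trivial hx
  have e : g * x * g⁻¹ = ⁅g, x⁆ * x := by rw [commutatorElement_def]; group
  rw [e, gradedClass_mul (lcs_anti n.le_succ h) hx, gradedClass_of_mem_succ h, zero_add]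

/-- A function on `Γ_{n+1}` with values in an abelian group that is additive and vanishes on
`Γ_{n+2}` is determined by its values at the terms of weight `n + 1`. -/
theorem eq_sum_gradedClass_smul {M : Type*} [AddCommGroup M] {n : ℕ}
    (φ : FreeNilpotentGroup r c → M)
    (hmul : ∀ x ∈ lcs _ n, ∀ y ∈ lcs _ n, φ (x * y) = φ x + φ y)
    (hzero : ∀ x ∈ lcs _ (n + 1), φ x = 0) {x : FreeNilpotentGroup r c} (hx : x ∈ lcs _ n) :
    φ x = ∑ s : U.Index, U.gradedClass n x s • φ (U.u s.1 s.2) := by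
  by_cases hn : n < c
  · have h1 : φ 1 = 0 := hzero 1 (one_mem _)
    have hinv : ∀ y ∈ lcs _ n, φ y⁻¹ = - φ y := fun y hy => by
      rw [eq_neg_iff_add_eq_zero, ← hmul _ (inv_mem hy) _ hy, inv_mul_cancel, h1]
    have hz : ∀ y ∈ lcs _ n, ∀ k : ℤ, φ (y ^ k) = k • φ y := by
      intro y hy k
      induction k with
      | zero => simpa using h1
      | succ k ih => rw [zpow_add_one, hmul _ (zpow_mem hy _) _ hy, ih, add_smul, one_smul]
      | pred k ih => rw [zpow_sub_one, hmul _ (zpow_mem hy _) _ (inv_mem hy), ih, hinv _ hy,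
          sub_smul, one_smul, sub_eq_add_neg]
    have hp : ∀ (m : ℕ) (w : Fin m → FreeNilpotentGroup r c), (∀ j, w j ∈ lcs _ n) →
        ∀ a : Fin m → ℤ,
        (List.ofFn fun j => w j ^ a j).prod ∈ lcs _ n ∧
        φ (List.ofFn fun j => w j ^ a j).prod = ∑ j, a j • φ (w j) := by
      intro m
      induction m with
      | zero => intro w hw a; simpa using h1
      | succ m ih =>
        intro w hw a
        obtain ⟨i1, i2⟩ := ih (fun j => w j.succ) (fun j => hw _) fun j => a j.succ
        rw [List.ofFn_succ, List.prod_cons, Fin.sum_univ_succ, ← i2, ← hz _ (hw 0)]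
        exact ⟨mul_mem (zpow_mem (hw 0) _) i1, hmul _ (zpow_mem (hw 0) _) _ i1⟩
    obtain ⟨p1, p2⟩ := hp _ (U.u ⟨n, hn⟩) (U.mem ⟨n, hn⟩) (U.coord ⟨n, hn⟩ x)
    have hs := hzero _ (coord_spec (U := U) (i := ⟨n, hn⟩) hx)
    rw [hmul _ (inv_mem hx) _ p1, hinv _ hx, neg_add_eq_zero] at hs
    rw [hs, p2]
    symm
    rw [Fintype.sum_sigma, Finset.sum_eq_single ⟨n, hn⟩]
    · simp [gradedClass]
    · intro i _ hi
      refine Finset.sum_eq_zero fun j _ => ?_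
      have : (i : ℕ) ≠ n := fun e => hi (Fin.ext e)
      simp [gradedClass, this]
    · simp
  · rw [eq_one_of_mem_lcs (by omega) hx, hzero 1 (one_mem _), gradedClass_one]
    simp

/-! ### The graded Lie ring of the lower central series -/

variable {i j k n : ℕ} {x y z : FreeNilpotentGroup r c}

theorem gradedClass_commutator_mul_left (hn : n = i + j + 1) {x' : FreeNilpotentGroup r c}
    (hx : x ∈ lcs _ i) (hx' : x' ∈ lcs _ i) (hy : y ∈ lcs _ j) :
    U.gradedClass n ⁅x * x', y⁆ = U.gradedClass n ⁅x, y⁆ + U.gradedClass n ⁅x', y⁆ := by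
  have e : ⁅x * x', y⁆ = x * ⁅x', y⁆ * x⁻¹ * ⁅x, y⁆ := by
    simp only [commutatorElement_def]; group
  have h := commutator_mem_lcs hn hx' hy
  rw [e, gradedClass_mul (conj_mem_lcs h x) (commutator_mem_lcs hn hx hy), gradedClass_conj h,
    add_comm]

theorem gradedClass_commutator_swap (hn : n = i + j + 1) (hx : x ∈ lcs _ i)
    (hy : y ∈ lcs _ j) : U.gradedClass n ⁅x, y⁆ = - U.gradedClass n ⁅y, x⁆ := by
  rw [← commutatorElement_inv y x, gradedClass_inv (commutator_mem_lcs (by omega) hy hx)]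

theorem gradedClass_commutator_mul_right (hn : n = i + j + 1) {y' : FreeNilpotentGroup r c}
    (hx : x ∈ lcs _ i) (hy : y ∈ lcs _ j) (hy' : y' ∈ lcs _ j) :
    U.gradedClass n ⁅x, y * y'⁆ = U.gradedClass n ⁅x, y⁆ + U.gradedClass n ⁅x, y'⁆ := by
  rw [gradedClass_commutator_swap hn hx (mul_mem hy hy'),
    gradedClass_commutator_mul_left (by omega) hy hy' hx, gradedClass_commutator_swap hn hx hy,
    gradedClass_commutator_swap hn hx hy', neg_add]

theorem gradedClass_commutator_of_mem_succ_left (hn : n = i + j + 1) (hx : x ∈ lcs _ (i + 1))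
    (hy : y ∈ lcs _ j) : U.gradedClass n ⁅x, y⁆ = 0 :=
  gradedClass_of_mem_succ (commutator_mem_lcs (by omega) hx hy)

theorem gradedClass_commutator_of_mem_succ_right (hn : n = i + j + 1) (hx : x ∈ lcs _ i)
    (hy : y ∈ lcs _ (j + 1)) : U.gradedClass n ⁅x, y⁆ = 0 :=
  gradedClass_of_mem_succ (commutator_mem_lcs (by omega) hx hy)

/-- The class of a commutator, as a linear function of the class of the first entry. -/
theorem gradedClass_commutator_eq_sum_left (hn : n = i + j + 1) (hx : x ∈ lcs _ i)
    (hy : y ∈ lcs _ j) : U.gradedClass n ⁅x, y⁆ =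
      ∑ s : U.Index, U.gradedClass i x s • U.gradedClass n ⁅U.u s.1 s.2, y⁆ :=
  eq_sum_gradedClass_smul (fun x => U.gradedClass n ⁅x, y⁆)
    (fun _ hx _ hx' => gradedClass_commutator_mul_left hn hx hx' hy)
    (fun _ hx => gradedClass_commutator_of_mem_succ_left hn hx hy) hx

theorem gradedClass_commutator_eq_sum_right (hn : n = i + j + 1) (hx : x ∈ lcs _ i)
    (hy : y ∈ lcs _ j) : U.gradedClass n ⁅x, y⁆ =
      ∑ s : U.Index, U.gradedClass j y s • U.gradedClass n ⁅x, U.u s.1 s.2⁆ :=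
  eq_sum_gradedClass_smul (fun y => U.gradedClass n ⁅x, y⁆)
    (fun _ hy _ hy' => gradedClass_commutator_mul_right hn hx hy hy')
    (fun _ hy => gradedClass_commutator_of_mem_succ_right hn hx hy) hy

theorem gradedClass_commutator_inv_left (hn : n = i + j + 1) (hx : x ∈ lcs _ i)
    (hy : y ∈ lcs _ j) : U.gradedClass n ⁅x⁻¹, y⁆ = - U.gradedClass n ⁅x, y⁆ := by
  rw [eq_neg_iff_add_eq_zero, ← gradedClass_commutator_mul_left hn (inv_mem hx) hx hy,
    inv_mul_cancel, commutatorElement_one_left, gradedClass_one]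

theorem gradedClass_commutator_inv_right (hn : n = i + j + 1) (hx : x ∈ lcs _ i)
    (hy : y ∈ lcs _ j) : U.gradedClass n ⁅x, y⁻¹⁆ = - U.gradedClass n ⁅x, y⁆ := by
  rw [eq_neg_iff_add_eq_zero, ← gradedClass_commutator_mul_right hn hx (inv_mem hy) hy,
    inv_mul_cancel, commutatorElement_one_right, gradedClass_one]

theorem gradedClass_commutator_congr_right (hn : n = i + j + 1) {y' : FreeNilpotentGroup r c}
    (hx : x ∈ lcs _ i) (hy : y ∈ lcs _ j) (hy' : y' ∈ lcs _ j)
    (h : U.gradedClass j y = U.gradedClass j y') :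
    U.gradedClass n ⁅x, y⁆ = U.gradedClass n ⁅x, y'⁆ := by
  rw [gradedClass_commutator_eq_sum_right hn hx hy,
    gradedClass_commutator_eq_sum_right hn hx hy', h]

/-- The Jacobi identity, from the Hall–Witt identity. -/
theorem gradedClass_jacobi (hn : n = i + j + k + 2) (hx : x ∈ lcs _ i) (hy : y ∈ lcs _ j)
    (hz : z ∈ lcs _ k) :
    U.gradedClass n ⁅z, ⁅x, y⁆⁆ + U.gradedClass n ⁅y, ⁅z, x⁆⁆ +
      U.gradedClass n ⁅x, ⁅y, z⁆⁆ = 0 := by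
  have e : ⁅z, ⁅x, y⁆⁆ =
      x * ((z * ⁅y, ⁅z⁻¹, x⁻¹⁆⁆⁻¹ * z⁻¹) * (y * ⁅x⁻¹, ⁅y⁻¹, z⁆⁆⁻¹ * y⁻¹)) * x⁻¹ := by
    simp only [commutatorElement_def]; group
  have hzx := commutator_mem_lcs rfl (inv_mem hz) (inv_mem hx)
  have hyz := commutator_mem_lcs rfl (inv_mem hy) hz
  have h1 : ⁅y, ⁅z⁻¹, x⁻¹⁆⁆ ∈ lcs _ n := commutator_mem_lcs (by omega) hy hzx
  have h2 : ⁅x⁻¹, ⁅y⁻¹, z⁆⁆ ∈ lcs _ n := commutator_mem_lcs (by omega) (inv_mem hx) hyz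
  rw [e, gradedClass_conj (mul_mem (conj_mem_lcs (inv_mem h1) z) (conj_mem_lcs (inv_mem h2) y)),
    gradedClass_mul (conj_mem_lcs (inv_mem h1) z) (conj_mem_lcs (inv_mem h2) y),
    gradedClass_conj (inv_mem h1), gradedClass_conj (inv_mem h2), gradedClass_inv h1,
    gradedClass_inv h2, gradedClass_commutator_inv_left (by omega) hx hyz,
    gradedClass_commutator_congr_right (y' := ⁅y, z⁆⁻¹) (by omega) hx hyz
      (inv_mem (commutator_mem_lcs rfl hy hz)),
    gradedClass_commutator_inv_right (by omega) hx (commutator_mem_lcs rfl hy hz),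
    gradedClass_commutator_congr_right (y' := ⁅z, x⁆) (by omega) hy hzx
      (commutator_mem_lcs rfl hz hx)]
  · abel
  · rw [gradedClass_commutator_inv_left rfl hz (inv_mem hx),
      gradedClass_commutator_inv_right rfl hz hx, neg_neg]
  · rw [gradedClass_commutator_inv_left rfl hy hz, gradedClass_inv (commutator_mem_lcs rfl hy hz)]

end HallBasicSequence

/-! ### The Magnus representation -/

namespace TruncSeries

variable {A : Type*} [Ring A] {c : ℕ}

/-- The units of `A⟦t⟧ / (t ^ (c + 1))` that are congruent to `1` modulo `t ^ i`. -/
def unipotent (A : Type*) [Ring A] (c i : ℕ) : Subgroup (TruncSeries A c)ˣ where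
  carrier := {g | (g : TruncSeries A c) - 1 ∈ filtration i}
  one_mem' := by simp [zero_mem]
  mul_mem' hx hy := by
    rw [Set.mem_ofPred_eq, Units.val_mul]
    exact mul_sub_one_mem hx hy
  inv_mem' {g} hg := by
    have : ((g⁻¹ : (TruncSeries A c)ˣ) : TruncSeries A c) - 1 =
        -(((g⁻¹ : (TruncSeries A c)ˣ) : TruncSeries A c) * ((g : TruncSeries A c) - 1)) := by
      rw [mul_sub, Units.inv_mul, mul_one, neg_sub]
    rw [Set.mem_ofPred_eq, this]
    exact neg_mem (mul_mem_left _ hg)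

theorem commutator_units_mul (g h : (TruncSeries A c)ˣ) :
    ((⁅g, h⁆ : (TruncSeries A c)ˣ) : TruncSeries A c) * (h * g) = g * h := by
  rw [← Units.val_mul, ← Units.val_mul, ← Units.val_mul, commutatorElement_def]
  congr 1
  group

theorem lcs_le_comap_unipotent {Γ : Type*} [Group Γ] (ψ : Γ →* (TruncSeries A c)ˣ)
    (h : ∀ x, ψ x ∈ unipotent A c 1) (n : ℕ) : lcs Γ n ≤ (unipotent A c (n + 1)).comap ψ := by
  induction n with
  | zero => exact fun x _ => h x
  | succ n ih =>
    refine Subgroup.commutator_le.2 fun x hx y _ => ?_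
    rw [Subgroup.mem_comap, map_commutatorElement]
    refine commutator_sub_one_mem (ih hx) (h y) ?_ (commutator_units_mul _ _)
    rw [← Units.val_mul]
    exact Units.isUnit _

end TruncSeries

/-- Additive functions on a term of the lower central series agree if they agree on commutators. -/
theorem eq_on_lcs_succ {Γ M : Type*} [Group Γ] [AddCommGroup M] {n : ℕ} (φ ψ : Γ → M)
    (hφ : ∀ x ∈ lcs Γ (n + 1), ∀ y ∈ lcs Γ (n + 1), φ (x * y) = φ x + φ y)
    (hψ : ∀ x ∈ lcs Γ (n + 1), ∀ y ∈ lcs Γ (n + 1), ψ (x * y) = ψ x + ψ y)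
    (h : ∀ p ∈ lcs Γ n, ∀ x, φ ⁅p, x⁆ = ψ ⁅p, x⁆) {y : Γ} (hy : y ∈ lcs Γ (n + 1)) :
    φ y = ψ y := by
  have one : ∀ χ : Γ → M, (∀ x ∈ lcs Γ (n + 1), ∀ y ∈ lcs Γ (n + 1), χ (x * y) = χ x + χ y) →
      χ 1 = 0 := fun χ hχ => by simpa using hχ 1 (one_mem _) 1 (one_mem _)
  refine Subgroup.closure_induction (p := fun y _ => φ y = ψ y) ?_ ?_ ?_ ?_ hy
  · rintro _ ⟨p, hp, x, -, rfl⟩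
    exact h p hp x
  · rw [one φ hφ, one ψ hψ]
  · intro x y hx hy h1 h2
    rw [hφ x hx y hy, hψ x hx y hy, h1, h2]
  · intro x hx h1
    have e1 := hφ x hx x⁻¹ (inv_mem hx)
    have e2 := hψ x hx x⁻¹ (inv_mem hx)
    rw [mul_inv_cancel, one φ hφ, h1] at e1
    rw [mul_inv_cancel, one ψ hψ] at e2
    exact add_left_cancel (e1.symm.trans e2)

namespace HallBasicSequence

open TruncSeries

variable {r c : ℕ} [NeZero c] (U : HallBasicSequence r c) (K : Type*) [CommRing K]

/-- The free associative algebra on letters `X_1, …, X_r` that correspond to the terms of weight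
one. -/
abbrev WordAlgebra : Type _ := MonoidAlgebra K (FreeMonoid (Fin (U.n 0)))

/-- The letter `X_k`. -/
def letter (k : Fin (U.n 0)) : U.WordAlgebra K := MonoidAlgebra.single (FreeMonoid.of k) 1

/-- The linear form `∑ k, a_k X_k`. -/
def linearForm (a : Fin (U.n 0) → K) : U.WordAlgebra K := ∑ k, a k • U.letter K k

/-- The ring in which the Magnus representation takes its values: words of length `n` appear in
degree `n`, and degrees above `c` are discarded. -/
abbrev MagnusRing : Type _ := TruncSeries (U.WordAlgebra K) c

/-- The image of the generator `x_l` of the free group: `1 + (∑ k, a_k X_k) t`, where the `a_k` are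
the coordinates of `x_l` relative to the terms of weight one. With this choice the `k`-th term of
weight one is sent to `1 + X_k t + ⋯`. -/
def magnusGenerator (l : Fin r) : (U.MagnusRing K)ˣ :=
  (isUnit_of_sub_one_mem (x := 1 + monomial 1 (U.linearForm K fun k =>
      (U.gradedClass 0 (QuotientGroup.mk (FreeGroup.of l)) ⟨0, k⟩ : K))) (by
    intro k hk
    rw [add_sub_cancel_left, coeff_monomial, if_neg (by omega)])).unit

theorem magnusGenerator_val (l : Fin r) : (U.magnusGenerator K l : U.MagnusRing K) - 1 =
    monomial 1 (U.linearForm K fun k =>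
      (U.gradedClass 0 (QuotientGroup.mk (FreeGroup.of l)) ⟨0, k⟩ : K)) :=
  add_sub_cancel_left _ _

theorem lift_magnusGenerator_mem (x : FreeGroup (Fin r)) :
    FreeGroup.lift (U.magnusGenerator K) x ∈ unipotent (U.WordAlgebra K) c 1 := by
  have : (FreeGroup.lift (U.magnusGenerator K)).range ≤ unipotent (U.WordAlgebra K) c 1 := by
    rw [FreeGroup.range_lift_eq_closure, Subgroup.closure_le]
    rintro _ ⟨l, rfl⟩ k hk
    rw [magnusGenerator_val, coeff_monomial, if_neg (by omega)]
  exact this ⟨x, rfl⟩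

/-- The Magnus representation of the free nilpotent group. -/
def magnus : FreeNilpotentGroup r c →* (U.MagnusRing K)ˣ :=
  QuotientGroup.lift _ (FreeGroup.lift (U.magnusGenerator K)) fun x hx => by
    have := lcs_le_comap_unipotent _ (U.lift_magnusGenerator_mem K) c hx
    exact Units.ext (sub_eq_zero.1 (eq_zero_of_mem c.lt_succ_self this))

theorem magnus_mk (x : FreeGroup (Fin r)) :
    U.magnus K (QuotientGroup.mk x) = FreeGroup.lift (U.magnusGenerator K) x := rfl

variable {K}

theorem magnus_sub_one_mem {n : ℕ} {x : FreeNilpotentGroup r c} (hx : x ∈ lcs _ n) :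
    (U.magnus K x : U.MagnusRing K) - 1 ∈ filtration (n + 1) := by
  refine lcs_le_comap_unipotent (U.magnus K) (fun x => ?_) n hx
  obtain ⟨x, rfl⟩ := QuotientGroup.mk_surjective x
  exact U.lift_magnusGenerator_mem K x

variable (K)

/-- The leading coefficient, in degree `n + 1`, of the image of an element of `Γ_{n+1}` under the
Magnus representation. -/
def leading (n : ℕ) (x : FreeNilpotentGroup r c) : U.WordAlgebra K :=
  coeff (n + 1) ((U.magnus K x : U.MagnusRing K) - 1)

variable {K}

theorem leading_mul {n : ℕ} {x y : FreeNilpotentGroup r c} (hx : x ∈ lcs _ n) :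
    U.leading K n (x * y) = U.leading K n x + U.leading K n y := by
  have e : (U.magnus K (x * y) : U.MagnusRing K) - 1 =
      ((U.magnus K x : U.MagnusRing K) - 1) * (U.magnus K y : U.MagnusRing K) +
        ((U.magnus K y : U.MagnusRing K) - 1) := by
    rw [map_mul, Units.val_mul, sub_mul, one_mul, sub_add_sub_cancel]
  rw [leading, e, map_add, coeff_mul_unipotent (U.magnus_sub_one_mem hx)
    (U.magnus_sub_one_mem (n := 0) trivial)]
  rfl

theorem leading_of_mem_succ {n : ℕ} {x : FreeNilpotentGroup r c} (hx : x ∈ lcs _ (n + 1)) :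
    U.leading K n x = 0 := U.magnus_sub_one_mem hx _ (Nat.lt_succ_self _)

theorem leading_one (n : ℕ) : U.leading K n 1 = 0 := U.leading_of_mem_succ (one_mem _)

theorem leading_commutator {n : ℕ} (hn : n + 2 ≤ c) {p x : FreeNilpotentGroup r c}
    (hp : p ∈ lcs _ n) : U.leading K (n + 1) ⁅p, x⁆ =
      U.leading K n p * U.leading K 0 x - U.leading K 0 x * U.leading K n p := by
  have h1 := U.magnus_sub_one_mem (K := K) hp
  have h2 := U.magnus_sub_one_mem (K := K) (n := 0) (x := x) trivial
  refine coeff_commutator (i := n + 1) (j := 1) hn h1 h2 ?_ ?_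
  · rw [← Units.val_mul, ← map_mul]
    exact U.magnus_sub_one_mem (n := 0) trivial
  · rw [map_commutatorElement]
    exact commutator_units_mul _ _

theorem leading_zero (x : FreeNilpotentGroup r c) :
    U.leading K 0 x = U.linearForm K fun k => (U.gradedClass 0 x ⟨0, k⟩ : K) := by
  have hone : ∀ n, (1 : FreeNilpotentGroup r c) ∈ lcs (FreeNilpotentGroup r c) n :=
    fun _ => one_mem _
  have hadd : ∀ x y : FreeNilpotentGroup r c,
      (U.linearForm K fun k => (U.gradedClass 0 (x * y) ⟨0, k⟩ : K)) =
      (U.linearForm K fun k => (U.gradedClass 0 x ⟨0, k⟩ : K)) +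
        U.linearForm K fun k => (U.gradedClass 0 y ⟨0, k⟩ : K) := by
    intro x y
    rw [gradedClass_mul (n := 0) (x := x) (y := y) trivial trivial]
    simp [linearForm, add_smul, Finset.sum_add_distrib]
  have hmul : ∀ x y : FreeNilpotentGroup r c,
      U.leading K 0 (x * y) = U.leading K 0 x + U.leading K 0 y :=
    fun x y => U.leading_mul (n := 0) trivial
  have h1 : (U.linearForm K fun k =>
      (U.gradedClass 0 (1 : FreeNilpotentGroup r c) ⟨0, k⟩ : K)) = 0 := by
    simp [linearForm, gradedClass_one]
  obtain ⟨x, rfl⟩ := QuotientGroup.mk_surjective x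
  induction x using FreeGroup.induction_on with
  | C1 => exact (U.leading_one 0).trans h1.symm
  | of l =>
    rw [leading, magnus_mk, FreeGroup.lift_apply_of, magnusGenerator_val, coeff_monomial,
      if_pos ⟨rfl, NeZero.one_le⟩]
  | inv_of l ih =>
    have e1 := hmul (QuotientGroup.mk (FreeGroup.of l)) (QuotientGroup.mk (FreeGroup.of l))⁻¹
    have e2 := hadd (QuotientGroup.mk (FreeGroup.of l)) (QuotientGroup.mk (FreeGroup.of l))⁻¹
    rw [mul_inv_cancel, leading_one, ih] at e1
    rw [mul_inv_cancel, h1] at e2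
    exact add_left_cancel (e1.symm.trans e2)
  | mul x y hx hy =>
    rw [QuotientGroup.mk_mul, hmul, hadd, hx, hy]

/-! ### The action of words by iterated commutators -/

variable (K)

/-- An integral vector indexed by the terms of the sequence, extended by `0` to a vector that has
one more coordinate, `none`. -/
def castVec (v : U.Index → ℤ) : Option U.Index → K := fun o => o.elim 0 fun s => (v s : K)

/-- The matrix of the action `v ↦ [v, u_{1k}]` of the letter `X_k` on the graded Lie ring, acting on
row vectors. The graded Lie ring is extended by one basis vector, `none`, on which `X_k` acts with
value `u_{1k}`; thus a word `X_{k_1} ⋯ X_{k_m}` sends this vector to the left-normed commutator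
`[u_{1k_1}, …, u_{1k_m}]`. -/
def adMatrix (k : Fin (U.n 0)) : Matrix (Option U.Index) (Option U.Index) K :=
  Matrix.of fun o => o.elim (U.castVec K (Pi.single ⟨0, k⟩ 1))
    fun s => U.castVec K (U.gradedClass (s.1 + 1) ⁅U.u s.1 s.2, U.u 0 k⁆)

/-- The action of the free associative algebra by iterated commutators. -/
def adAction : U.WordAlgebra K →ₐ[K] Matrix (Option U.Index) (Option U.Index) K :=
  MonoidAlgebra.lift K _ _ (FreeMonoid.lift (U.adMatrix K))

variable {K} {U}

theorem adAction_letter (k : Fin (U.n 0)) : U.adAction K (U.letter K k) = U.adMatrix K k := by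
  simp [adAction, letter]

theorem adAction_linearForm (a : Fin (U.n 0) → K) :
    U.adAction K (U.linearForm K a) = ∑ k, a k • U.adMatrix K k := by
  simp [linearForm, adAction_letter]

theorem castVec_add (v w : U.Index → ℤ) : U.castVec K (v + w) = U.castVec K v + U.castVec K w := by
  ext o
  cases o <;> simp [castVec]

theorem castVec_neg (v : U.Index → ℤ) : U.castVec K (-v) = - U.castVec K v := by
  ext o
  cases o <;> simp [castVec]

theorem castVec_zero : U.castVec K (0 : U.Index → ℤ) = 0 := by
  ext o
  cases o <;> simp [castVec]

theorem castVec_sum_smul {ι : Type*} (t : Finset ι) (a : ι → ℤ) (v : ι → U.Index → ℤ) :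
    U.castVec K (∑ i ∈ t, a i • v i) = ∑ i ∈ t, (a i : K) • U.castVec K (v i) := by
  ext o
  cases o <;> simp [castVec, Finset.sum_apply]

theorem sum_gradedClass_smul {M : Type*} [AddCommMonoid M] [Module K M] (i : Fin c)
    (x : FreeNilpotentGroup r c) (F : U.Index → M) :
    ∑ s : U.Index, (U.gradedClass i x s : K) • F s =
      ∑ j, (U.gradedClass i x ⟨i, j⟩ : K) • F ⟨i, j⟩ := by
  rw [Fintype.sum_sigma, Finset.sum_eq_single i]
  · intro k _ hk
    refine Finset.sum_eq_zero fun j _ => ?_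
    simp [gradedClass, Fin.val_inj, hk]
  · simp

theorem castVec_gradedClass_vecMul_adMatrix {i : ℕ} {w : FreeNilpotentGroup r c}
    (hw : w ∈ lcs _ i) (k : Fin (U.n 0)) :
    Matrix.vecMul (U.castVec K (U.gradedClass i w)) (U.adMatrix K k) =
      U.castVec K (U.gradedClass (i + 1) ⁅w, U.u 0 k⁆) := by
  have h : ∀ s : U.Index, U.gradedClass i w s •
      U.gradedClass (i + 1) ⁅U.u s.1 s.2, U.u 0 k⁆ =
      U.gradedClass i w s • U.gradedClass (s.1 + 1) ⁅U.u s.1 s.2, U.u 0 k⁆ := by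
    intro s
    by_cases hs : (s.1 : ℕ) = i
    · rw [hs]
    · simp [gradedClass, hs]
  rw [gradedClass_commutator_eq_sum_left (j := 0) rfl hw trivial,
    Finset.sum_congr rfl fun s _ => h s,
    castVec_sum_smul]
  ext o
  simp only [Matrix.vecMul, dotProduct, Fintype.sum_option, castVec, Option.elim, zero_mul,
    zero_add, Finset.sum_apply, Pi.smul_apply, smul_eq_mul, adMatrix, Matrix.of_apply]

theorem castVec_gradedClass_commutator_zero (y : FreeNilpotentGroup r c)
    {i : ℕ} {w : FreeNilpotentGroup r c} (hw : w ∈ lcs _ i) :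
    U.castVec K (U.gradedClass (i + 1) ⁅w, y⁆) =
      Matrix.vecMul (U.castVec K (U.gradedClass i w)) (U.adAction K (U.leading K 0 y)) := by
  rw [leading_zero, adAction_linearForm,
    gradedClass_commutator_eq_sum_right (j := 0) rfl hw trivial, castVec_sum_smul]
  have := sum_gradedClass_smul (K := K) (U := U) 0 y fun s =>
    U.castVec K (U.gradedClass (i + 1) ⁅w, U.u s.1 s.2⁆)
  rw [Fin.coe_ofNat_eq_mod, Nat.zero_mod] at this
  rw [this, Matrix.vecMul_sum]
  refine Finset.sum_congr rfl fun k _ => ?_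
  rw [Matrix.vecMul_smul, castVec_gradedClass_vecMul_adMatrix hw]

/-- The leading coefficient of `y ∈ Γ_{j+1}` acts on the graded Lie ring as the commutator with
`y`. -/
theorem castVec_gradedClass_commutator (j : ℕ) {y : FreeNilpotentGroup r c} (hy : y ∈ lcs _ j)
    {i : ℕ} {w : FreeNilpotentGroup r c} (hw : w ∈ lcs _ i) {n : ℕ} (hn : n = i + j + 1) :
    U.castVec K (U.gradedClass n ⁅w, y⁆) =
      Matrix.vecMul (U.castVec K (U.gradedClass i w)) (U.adAction K (U.leading K j y)) := by
  induction j generalizing y i w n with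
  | zero =>
    subst hn
    exact castVec_gradedClass_commutator_zero y hw
  | succ j ih =>
    by_cases hj : j + 2 ≤ c
    · refine eq_on_lcs_succ (fun y => U.castVec K (U.gradedClass n ⁅w, y⁆))
        (fun y => Matrix.vecMul (U.castVec K (U.gradedClass i w))
          (U.adAction K (U.leading K (j + 1) y))) ?_ ?_ ?_ hy
      · intro x hx y hy
        rw [gradedClass_commutator_mul_right hn hw hx hy, castVec_add]
      · intro x hx y hy
        rw [leading_mul U hx, map_add, Matrix.vecMul_add]
      · intro p hp x
        have hx : x ∈ lcs (FreeNilpotentGroup r c) 0 := trivial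
        have hwp := commutator_mem_lcs (n := i + j + 1) rfl hw hp
        have hwx := commutator_mem_lcs (n := i + 1) rfl hw hx
        have hxw := commutator_mem_lcs (n := i + 1) (by omega) hx hw
        rw [leading_commutator U hj hp, map_sub, Matrix.vecMul_sub, map_mul, map_mul,
          ← Matrix.vecMul_vecMul, ← Matrix.vecMul_vecMul, ← ih hp hw rfl,
          ← castVec_gradedClass_commutator_zero x hw,
          ← castVec_gradedClass_commutator_zero x hwp, ← ih hp hwx (n := n) (by omega),
          eq_sub_iff_add_eq, ← castVec_add, show i + j + 1 + 1 = n by omega]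
        have hJ := gradedClass_jacobi (U := U) (n := n) (by omega) hp hx hw
        rw [gradedClass_commutator_swap (n := n) (by omega) hx hwp,
          gradedClass_commutator_swap (n := n) (by omega) hp hxw,
          ← commutatorElement_inv w x,
          gradedClass_commutator_inv_left (n := n) (by omega) hwx hp, neg_neg] at hJ
        congr 1
        rw [← sub_eq_zero, ← hJ]
        abel
    · have : y = 1 := eq_one_of_mem_lcs (by omega) hy
      subst this
      rw [commutatorElement_one_right, gradedClass_one, castVec_zero, leading_one, map_zero,
        Matrix.vecMul_zero]

/-- The Dynkin–Specht–Wever lemma: the left-normed bracketing of the leading coefficient of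
`y ∈ Γ_{j+1}` is `j + 1` times the class of `y`. In particular the leading coefficient determines
the class of `y` as soon as integers are invertible. -/
theorem vecMul_none_leading (j : ℕ) {y : FreeNilpotentGroup r c} (hy : y ∈ lcs _ j) :
    Matrix.vecMul (Pi.single none 1) (U.adAction K (U.leading K j y)) =
      ((j + 1 : ℕ) : K) • U.castVec K (U.gradedClass j y) := by
  have hzero : ∀ x : FreeNilpotentGroup r c,
      Matrix.vecMul (Pi.single none 1) (U.adAction K (U.leading K 0 x)) =
        U.castVec K (U.gradedClass 0 x) := by
    intro x
    have h := eq_sum_gradedClass_smul (U := U) (n := 0) (U.gradedClass 0)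
      (fun _ hx _ hy => gradedClass_mul hx hy) (fun _ hx => gradedClass_of_mem_succ hx) (x := x)
      trivial
    have := sum_gradedClass_smul (K := K) (U := U) 0 x fun s =>
      U.castVec K (U.gradedClass 0 (U.u s.1 s.2))
    rw [Fin.coe_ofNat_eq_mod, Nat.zero_mod] at this
    conv_rhs => rw [h, castVec_sum_smul, this]
    rw [leading_zero, adAction_linearForm, Matrix.vecMul_sum]
    refine Finset.sum_congr rfl fun k _ => ?_
    have hu := gradedClass_u (U := U) ⟨0, k⟩
    rw [Fin.coe_ofNat_eq_mod, Nat.zero_mod] at hu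
    rw [Matrix.vecMul_smul, Matrix.single_one_vecMul, hu]
    rfl
  induction j generalizing y with
  | zero => rw [hzero, zero_add, Nat.cast_one, one_smul]
  | succ j ih =>
    by_cases hj : j + 2 ≤ c
    · refine eq_on_lcs_succ (fun y => Matrix.vecMul (Pi.single none 1)
          (U.adAction K (U.leading K (j + 1) y)))
        (fun y => ((j + 1 + 1 : ℕ) : K) • U.castVec K (U.gradedClass (j + 1) y)) ?_ ?_ ?_ hy
      · intro x hx y hy
        rw [leading_mul U hx, map_add, Matrix.vecMul_add]
      · intro x hx y hy
        rw [gradedClass_mul hx hy, castVec_add, smul_add]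
      · intro p hp x
        have hx : x ∈ lcs (FreeNilpotentGroup r c) 0 := trivial
        rw [leading_commutator U hj hp, map_sub, Matrix.vecMul_sub, map_mul, map_mul,
          ← Matrix.vecMul_vecMul, ← Matrix.vecMul_vecMul, ih hp, hzero,
          ← castVec_gradedClass_commutator j hp hx (n := j + 1) (by omega), Matrix.smul_vecMul,
          ← castVec_gradedClass_commutator_zero x hp,
          gradedClass_commutator_swap (n := j + 1) (by omega) hx hp, castVec_neg, sub_neg_eq_add]
        push_cast
        module
    · have : y = 1 := eq_one_of_mem_lcs (by omega) hy
      subst this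
      rw [gradedClass_one, castVec_zero, leading_one, map_zero, Matrix.vecMul_zero, smul_zero]

end HallBasicSequence

theorem List.prod_ofFn_of_eq_one {M : Type*} [Monoid M] {m : ℕ} (n : Fin m) (W W' : Fin m → M)
    (h : ∀ i, i ≤ n → W i = 1) (h' : ∀ i, i ≠ n → W' i = W i) :
    (List.ofFn W').prod = W' n * (List.ofFn W).prod := by
  induction m with
  | zero => exact n.elim0
  | succ m ih =>
    rw [List.ofFn_succ, List.ofFn_succ, List.prod_cons, List.prod_cons, h 0 (Fin.zero_le _),
      one_mul]
    refine Fin.cases (motive := fun n => (∀ i, i ≤ n → W i = 1) → (∀ i, i ≠ n → W' i = W i) →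
      W' 0 * (List.ofFn fun i => W' i.succ).prod = W' n * (List.ofFn fun i => W i.succ).prod)
      (fun _ h' => ?_) (fun n h h' => ?_) n h h'
    · simp only [h' _ (Fin.succ_ne_zero _)]
    · rw [h' 0 (Fin.succ_ne_zero _).symm, h 0 (Fin.zero_le _), one_mul]
      exact ih n _ _ (fun i hi => h _ (Fin.succ_le_succ_iff.2 hi))
        fun i hi => h' _ (by simpa using hi)

namespace HallBasicSequence

open TruncSeries

variable {r c : ℕ} [NeZero c] (U : HallBasicSequence r c)

/-! ### Normal forms -/

variable {U} in
theorem exists_normalForm_of_mem_lcs {n : ℕ} (hn : n ≤ c) {x : FreeNilpotentGroup r c}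
    (hx : x ∈ lcs _ n) :
    ∃ a : U.Index → ℤ, (∀ s : U.Index, (s.1 : ℕ) < n → a s = 0) ∧ U.normalForm a = x := by
  induction hn using Nat.decreasingInduction generalizing x with
  | self =>
    refine ⟨0, fun _ _ => rfl, ?_⟩
    rw [eq_one_of_mem_lcs le_rfl hx]
    simp [normalForm, List.ofFn_const]
  | of_succ n hn ih =>
    obtain ⟨a, ha, h⟩ := ih (inv_mem (coord_spec (U := U) (i := ⟨n, hn⟩) hx))
    refine ⟨fun s => if (s.1 : ℕ) = n then U.coord s.1 x s.2 else a s, fun s hs => ?_, ?_⟩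
    · exact (if_neg hs.ne).trans (ha s (by omega))
    · have h0 : ∀ i : Fin c, i ≤ ⟨n, hn⟩ →
          (List.ofFn fun j : Fin (U.n i) => U.u i j ^ a ⟨i, j⟩).prod = 1 := by
        intro i hi
        have : ∀ j, a ⟨i, j⟩ = 0 := fun j => ha _ (Nat.lt_succ_of_le hi)
        simp [this, List.ofFn_const]
      rw [normalForm, List.prod_ofFn_of_eq_one ⟨n, hn⟩ _ _ h0, ← normalForm, h]
      · simp
      · intro i hi
        have : (i : ℕ) ≠ n := fun e => hi (Fin.ext e)
        simp [this]

variable {U} in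
theorem exists_normalForm (x : FreeNilpotentGroup r c) : ∃ a, U.normalForm a = x := by
  obtain ⟨a, -, h⟩ :=
    exists_normalForm_of_mem_lcs (U := U) (n := 0) (Nat.zero_le _) (x := x) trivial
  exact ⟨a, h⟩

/-! ### Formal products inside the Magnus ring -/

section Leading

variable {K : Type*} [CommRing K] {U}

theorem magnus_u_sub_one_mem (s : U.Index) :
    (U.magnus K (U.u s.1 s.2) : U.MagnusRing K) - 1 ∈ filtration (s.1 + 1) :=
  U.magnus_sub_one_mem (U.mem s.1 s.2)

theorem adAction_leading (n : ℕ) {y : FreeNilpotentGroup r c} (hy : y ∈ lcs _ n) (t : U.Index) :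
    U.adAction K (U.leading K n y) none (some t) =
      ((n + 1 : ℕ) : K) * (U.gradedClass n y t : K) := by
  have := congrFun (vecMul_none_leading (K := K) (U := U) n hy) (some t)
  rw [Matrix.single_one_vecMul] at this
  simpa [castVec] using this

theorem adAction_sum_leading (n : ℕ) (b : U.Index → K) (t : U.Index) (ht : (t.1 : ℕ) = n) :
    U.adAction K (∑ s : U.Index, if (s.1 : ℕ) = n then b s • U.leading K n (U.u s.1 s.2) else 0)
      none (some t) = ((n + 1 : ℕ) : K) * b t := by
  rw [map_sum, Matrix.sum_apply, Finset.sum_eq_single t]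
  · subst ht
    rw [if_pos rfl, map_smul, Matrix.smul_apply, adAction_leading _ (U.mem _ _), gradedClass_u]
    simp [mul_comm]
  · intro s _ hs
    split_ifs with h
    · subst h
      rw [map_smul, Matrix.smul_apply, adAction_leading _ (U.mem _ _), gradedClass_u]
      simp [Pi.single_eq_of_ne hs.symm]
    · simp
  · simp

end Leading

section MagnusForm

variable (K : Type*) [CommRing K] [BinomialRing K]

/-- The image `∏ M(u_{ij}) ^ {a_{ij}}` of the formal product `u^a` in the Magnus ring, for exponents
in a binomial ring. -/
def magnusForm (a : U.Index → K) : U.MagnusRing K :=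
  (List.ofFn fun i : Fin c => (List.ofFn fun j : Fin (U.n i) =>
    bpow (U.magnus K (U.u i j) : U.MagnusRing K) (a ⟨i, j⟩)).prod).prod

variable {K} {U}

theorem bpow_magnus_sub_one_mem (s : U.Index) (l : K) :
    bpow (U.magnus K (U.u s.1 s.2) : U.MagnusRing K) l - 1 ∈ filtration (s.1 + 1) :=
  bpow_sub_one_mem (magnus_u_sub_one_mem s) l

/-- Comparison of two formal products whose exponents agree in weights at most `n`: they agree up to
degree `n`, and in degree `n + 1` the difference is linear in the exponents of weight `n + 1`. -/
theorem magnusForm_sub (n : ℕ) (a a' : U.Index → K)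
    (h : ∀ s : U.Index, (s.1 : ℕ) < n → a s = a' s) :
    U.magnusForm K a - 1 ∈ filtration 1 ∧
    U.magnusForm K a - U.magnusForm K a' ∈ filtration (n + 1) ∧
    coeff (n + 1) (U.magnusForm K a - U.magnusForm K a') =
      ∑ s : U.Index, if (s.1 : ℕ) = n then (a s - a' s) • U.leading K n (U.u s.1 s.2) else 0 := by
  have hu : ∀ (b : U.Index → K) (s : U.Index),
      bpow (U.magnus K (U.u s.1 s.2) : U.MagnusRing K) (b s) - 1 ∈ filtration 1 := fun b s =>
    filtration_anti (by omega) (bpow_magnus_sub_one_mem s _)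
  have hd : ∀ s : U.Index, bpow (U.magnus K (U.u s.1 s.2) : U.MagnusRing K) (a s) -
      bpow (U.magnus K (U.u s.1 s.2) : U.MagnusRing K) (a' s) ∈ filtration (n + 1) ∧
      coeff (n + 1) (bpow (U.magnus K (U.u s.1 s.2) : U.MagnusRing K) (a s) -
        bpow (U.magnus K (U.u s.1 s.2) : U.MagnusRing K) (a' s)) =
        if (s.1 : ℕ) = n then (a s - a' s) • U.leading K n (U.u s.1 s.2) else 0 := by
    intro s
    rw [← sub_sub_sub_cancel_right _ _ 1]
    have h1 := bpow_magnus_sub_one_mem s (a s)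
    have h2 := bpow_magnus_sub_one_mem s (a' s)
    rcases lt_trichotomy (s.1 : ℕ) n with hs | hs | hs
    · rw [h s hs, sub_self, if_neg hs.ne]
      exact ⟨zero_mem _, map_zero _⟩
    · subst hs
      refine ⟨sub_mem h1 h2, ?_⟩
      have hc : (s.1 : ℕ) + 1 ≤ c := s.1.2
      rw [map_sub, coeff_bpow_sub_one (by omega) hc (magnus_u_sub_one_mem s),
        coeff_bpow_sub_one (by omega) hc (magnus_u_sub_one_mem s), if_pos rfl, sub_smul]
      rfl
    · rw [if_neg hs.ne']
      have h3 := sub_mem (filtration_anti (by omega : n + 1 + 1 ≤ s.1 + 1) h1)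
        (filtration_anti (by omega : n + 1 + 1 ≤ s.1 + 1) h2)
      exact mem_filtration_succ.1 h3
  have hin : ∀ i : Fin c, _ := fun i => prod_ofFn_sub (m := n + 1)
    (fun j : Fin (U.n i) => bpow (U.magnus K (U.u i j) : U.MagnusRing K) (a ⟨i, j⟩))
    (fun j : Fin (U.n i) => bpow (U.magnus K (U.u i j) : U.MagnusRing K) (a' ⟨i, j⟩))
    (fun j => hu a ⟨i, j⟩) (fun j => hu a' ⟨i, j⟩) (fun j => (hd ⟨i, j⟩).1)
  have hin' : ∀ i : Fin c, _ := fun i => prod_ofFn_sub (m := 0)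
    (fun j : Fin (U.n i) => bpow (U.magnus K (U.u i j) : U.MagnusRing K) (a' ⟨i, j⟩))
    (fun j : Fin (U.n i) => bpow (U.magnus K (U.u i j) : U.MagnusRing K) (a' ⟨i, j⟩))
    (fun j => hu a' ⟨i, j⟩) (fun j => hu a' ⟨i, j⟩) (fun j => mem_filtration_zero _)
  obtain ⟨p1, p2, p3⟩ := prod_ofFn_sub (m := n + 1) _ _ (fun i => (hin i).1) (fun i => (hin' i).1)
    fun i => (hin i).2.1
  refine ⟨p1, p2, p3.trans ?_⟩
  rw [Fintype.sum_sigma]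
  refine Finset.sum_congr rfl fun i _ => (hin i).2.2.trans ?_
  exact Finset.sum_congr rfl fun j _ => (hd ⟨i, j⟩).2

theorem magnusForm_sub_one_mem (a : U.Index → K) : U.magnusForm K a - 1 ∈ filtration 1 :=
  (magnusForm_sub 0 a a fun _ _ => rfl).1

theorem magnusForm_zero : U.magnusForm K 0 = 1 := by
  simp [magnusForm, bpow_zero, List.ofFn_const]

theorem adAction_magnusForm_sub (n : ℕ) (a a' : U.Index → K)
    (h : ∀ s : U.Index, (s.1 : ℕ) < n → a s = a' s) (t : U.Index) (ht : (t.1 : ℕ) = n) :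
    U.adAction K (coeff (n + 1) (U.magnusForm K a - U.magnusForm K a')) none (some t) =
      ((n + 1 : ℕ) : K) * (a t - a' t) := by
  rw [(magnusForm_sub n a a' h).2.2]
  exact adAction_sum_leading n (fun s => a s - a' s) t ht

/-- Over the integers, formal products in the Magnus ring are the images of the actual products. -/
theorem magnusForm_intCast (a : U.Index → ℤ) :
    U.magnusForm K (fun s => (a s : K)) = (U.magnus K (U.normalForm a) : U.MagnusRing K) := by
  rw [normalForm, map_list_prod, ← Units.coeHom_apply, map_list_prod, magnusForm]
  simp only [List.map_ofFn, Function.comp_def, map_list_prod, Units.coeHom_apply, map_zpow]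
  refine congrArg List.prod (congrArg List.ofFn (funext fun i => congrArg List.prod
    (congrArg List.ofFn (funext fun j => ?_))))
  rw [bpow_intCast NeZero.one_le _ (filtration_anti (by omega) (magnus_u_sub_one_mem ⟨i, j⟩))]

end MagnusForm

/-! ### Recovering the exponents -/

section Extract

variable (K : Type*) [CommRing K] [BinomialRing K] [Algebra ℚ K]

/-- The exponents, in weights at most `n`, of an element of the Magnus ring that is the image of a
formal product. They are recovered weight by weight, by means of the Dynkin–Specht–Wever lemma. -/
def extract (g : U.MagnusRing K) : ℕ → U.Index → K
  | 0 => 0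
  | n + 1 => fun t => if (t.1 : ℕ) = n then
      ((n + 1 : ℕ) : ℚ)⁻¹ •
        U.adAction K (coeff (n + 1) (g - U.magnusForm K (extract g n))) none (some t)
    else extract g n t

variable {K} {U}

theorem extract_magnusForm (a : U.Index → K) (n : ℕ) (t : U.Index) :
    U.extract K (U.magnusForm K a) n t = if (t.1 : ℕ) < n then a t else 0 := by
  induction n generalizing t with
  | zero => rfl
  | succ n ih =>
    simp only [extract]
    by_cases h : (t.1 : ℕ) = n
    · rw [if_pos h, if_pos (by omega), adAction_magnusForm_sub n _ _ _ t h, ih, if_neg (by omega),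
        sub_zero, ← nsmul_eq_mul, ← Nat.cast_smul_eq_nsmul ℚ, smul_smul, inv_mul_cancel₀, one_smul]
      · exact_mod_cast Nat.succ_ne_zero n
      · intro s hs
        rw [ih, if_pos hs]
    · rw [if_neg h, ih]
      exact if_congr (by omega) rfl rfl

theorem extract_magnusForm_top (a : U.Index → K) : U.extract K (U.magnusForm K a) c = a := by
  ext t
  rw [extract_magnusForm, if_pos t.1.2]

theorem magnusForm_injective : Function.Injective (U.magnusForm K) := fun a a' h => by
  rw [← extract_magnusForm_top a, h, extract_magnusForm_top]

end Extract

/-! ### Change of coefficients -/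

section ChangeOfRings

variable {K K' : Type*} [CommRing K] [CommRing K'] (σ : K →+* K')

/-- The homomorphism of Magnus rings induced by a homomorphism of coefficient rings. -/
def magnusMap : U.MagnusRing K →+* U.MagnusRing K' :=
  TruncSeries.map (MonoidAlgebra.mapRingHom _ σ)

theorem mapRingHom_linearForm (a : Fin (U.n 0) → K) :
    MonoidAlgebra.mapRingHom _ σ (U.linearForm K a) = U.linearForm K' fun k => σ (a k) := by
  simp [linearForm, letter]

theorem magnusMap_magnus (x : FreeNilpotentGroup r c) :
    U.magnusMap σ (U.magnus K x : U.MagnusRing K) = U.magnus K' x := by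
  obtain ⟨x, rfl⟩ := QuotientGroup.mk_surjective x
  have : (Units.map (U.magnusMap σ : U.MagnusRing K →* U.MagnusRing K')).comp
      (FreeGroup.lift (U.magnusGenerator K)) = FreeGroup.lift (U.magnusGenerator K') := by
    ext1 l
    ext1
    simp only [MonoidHom.comp_apply, FreeGroup.lift_apply_of, Units.coe_map, MonoidHom.coe_coe]
    rw [← sub_left_inj (a := 1), magnusGenerator_val, ← map_one (U.magnusMap σ), ← map_sub,
      magnusGenerator_val, magnusMap]
    ext1 n hn
    rw [coeff_map, coeff_monomial, coeff_monomial, apply_ite (MonoidAlgebra.mapRingHom _ σ),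
      map_zero, mapRingHom_linearForm]
    simp
  exact congrArg Units.val (DFunLike.congr_fun this x)

theorem adAction_mapRingHom (ξ : U.WordAlgebra K) (o o' : Option U.Index) :
    U.adAction K' (MonoidAlgebra.mapRingHom _ σ ξ) o o' = σ (U.adAction K ξ o o') := by
  have hletter : ∀ k, U.adMatrix K' k = σ.mapMatrix (U.adMatrix K k) := by
    intro k
    ext o o'
    cases o <;> cases o' <;> simp [adMatrix, castVec]
  have : ((U.adAction K').toRingHom.comp (MonoidAlgebra.mapRingHom _ σ)) =
      σ.mapMatrix.comp (U.adAction K).toRingHom := by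
    refine MonoidAlgebra.ringHom_ext (fun k => ?_) fun w => ?_
    · ext i j
      by_cases h : i = j
      · subst h; simp [adAction]
      · simp [adAction, h]
    · change U.adAction K' (MonoidAlgebra.mapRingHom _ σ (MonoidAlgebra.single w 1)) =
        σ.mapMatrix (U.adAction K (MonoidAlgebra.single w 1))
      rw [MonoidAlgebra.mapRingHom_single, map_one, adAction, MonoidAlgebra.lift_single, one_smul,
        adAction, MonoidAlgebra.lift_single, one_smul]
      induction w using FreeMonoid.inductionOn' with
      | one => simp
      | of_mul k w ih => rw [map_mul, map_mul, map_mul, ih, FreeMonoid.lift_eval_of,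
          FreeMonoid.lift_eval_of, hletter]
  exact congrFun (congrFun (DFunLike.congr_fun this ξ) o) o'

variable [BinomialRing K] [BinomialRing K']

theorem magnusMap_bpow (g : U.MagnusRing K) (l : K) :
    U.magnusMap σ (bpow g l) = bpow (U.magnusMap σ g) (σ l) := by
  refine map_bpow σ _ (fun k ξ => ?_) g l
  ext w
  simp

theorem magnusMap_magnusForm (a : U.Index → K) :
    U.magnusMap σ (U.magnusForm K a) = U.magnusForm K' fun s => σ (a s) := by
  simp only [magnusForm, map_list_prod, List.map_ofFn, Function.comp_def, magnusMap_bpow,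
    magnusMap_magnus]

theorem extract_magnusMap [Algebra ℚ K] [Algebra ℚ K'] (g : U.MagnusRing K) (n : ℕ) :
    U.extract K' (U.magnusMap σ g) n = fun t => σ (U.extract K g n t) := by
  induction n with
  | zero => ext; simp [extract]
  | succ n ih =>
    ext t
    simp only [extract]
    rw [ih, ← magnusMap_magnusForm, ← map_sub]
    split_ifs with h
    · rw [magnusMap, coeff_map, adAction_mapRingHom, map_rat_smul σ]
    · rfl

end ChangeOfRings

end HallBasicSequence

/-! ### Integer-valued polynomials -/

theorem Ring.mul_choose_self {R : Type*} [CommRing R] [BinomialRing R] (x : R) (k : ℕ) :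
    x * Ring.choose x k =
      ((k + 1 : ℕ) : R) * Ring.choose x (k + 1) + (k : R) * Ring.choose x k := by
  have h := Ring.choose_smul_choose x (Nat.le_succ k)
  rw [Nat.choose_succ_self_right, Nat.succ_eq_add_one, Nat.add_sub_cancel_left,
    Ring.choose_one_right, nsmul_eq_mul] at h
  rw [h]
  ring

namespace BinomialPolynomial

variable {σ : Type*}

theorem map_eval {R S : Type*} [CommRing R] [BinomialRing R] [CommRing S] [BinomialRing S]
    (f : R →+* S) (p : BinomialPolynomial σ) (x : σ → R) :
    f (p.eval x) = p.eval fun s => f (x s) := by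
  rw [eval, eval, Finsupp.sum, Finsupp.sum, map_sum]
  refine Finset.sum_congr rfl fun m _ => ?_
  rw [map_zsmul, Finsupp.prod, Finsupp.prod, map_prod]
  simp only [Ring.map_choose]

variable [Fintype σ]

open MvPolynomial

/-- The product `∏ s, (X_s choose m_s)` as a polynomial with rational coefficients. -/
def chooseProd (m : σ →₀ ℕ) : MvPolynomial σ ℚ := m.prod fun s k => Ring.choose (X s) k

theorem chooseProd_eq (m : σ →₀ ℕ) :
    chooseProd m = ∏ s, Ring.choose (X s : MvPolynomial σ ℚ) (m s) :=
  Finsupp.prod_fintype _ _ fun _ => Ring.choose_zero_right _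

theorem X_mul_chooseProd (s : σ) (m : σ →₀ ℕ) :
    X s * chooseProd m =
      ((m s + 1 : ℕ) : ℚ) • chooseProd (m + Finsupp.single s 1) + (m s : ℚ) • chooseProd m := by
  classical
  have h : ∀ m' : σ →₀ ℕ, (∀ t, t ≠ s → m' t = m t) → chooseProd m' =
      Ring.choose (X s : MvPolynomial σ ℚ) (m' s) *
        ∏ t ∈ Finset.univ.erase s, Ring.choose (X t : MvPolynomial σ ℚ) (m t) := by
    intro m' hm'
    rw [chooseProd_eq, ← Finset.mul_prod_erase _ _ (Finset.mem_univ s)]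
    congr 1
    exact Finset.prod_congr rfl fun t ht => by rw [hm' t (Finset.ne_of_mem_erase ht)]
  rw [h m fun _ _ => rfl, h (m + Finsupp.single s 1), ← mul_assoc, Ring.mul_choose_self,
    Nat.cast_smul_eq_nsmul, Nat.cast_smul_eq_nsmul, nsmul_eq_mul, nsmul_eq_mul]
  · simp only [Finsupp.add_apply, Finsupp.single_eq_same]
    ring
  · intro t ht
    simp [Finsupp.single_eq_of_ne ht]

theorem span_chooseProd : Submodule.span ℚ (Set.range (chooseProd (σ := σ))) = ⊤ := by
  rw [eq_top_iff]
  rintro P -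
  induction P using MvPolynomial.induction_on with
  | C a =>
    have : (C a : MvPolynomial σ ℚ) = a • chooseProd 0 := by
      simp [chooseProd, MvPolynomial.smul_eq_C_mul]
    rw [this]
    exact Submodule.smul_mem _ _ (Submodule.subset_span ⟨0, rfl⟩)
  | add p q hp hq => exact add_mem hp hq
  | mul_X p s hp =>
    rw [mul_comm]
    induction hp using Submodule.span_induction with
    | mem x hx =>
      obtain ⟨m, rfl⟩ := hx
      rw [X_mul_chooseProd]
      exact add_mem (Submodule.smul_mem _ _ (Submodule.subset_span ⟨_, rfl⟩))
        (Submodule.smul_mem _ _ (Submodule.subset_span ⟨_, rfl⟩))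
    | zero => simp
    | add x y _ _ hx hy => rw [mul_add]; exact add_mem hx hy
    | smul a x _ hx => rw [mul_smul_comm]; exact Submodule.smul_mem _ _ hx

theorem eval_chooseProd (m k : σ →₀ ℕ) :
    MvPolynomial.eval (fun s => (m s : ℚ)) (chooseProd k) = ∏ s, ((m s).choose (k s) : ℚ) := by
  rw [chooseProd_eq, map_prod]
  refine Finset.prod_congr rfl fun s _ => ?_
  rw [Ring.map_choose, MvPolynomial.eval_X, Ring.choose_natCast]

/-- A polynomial with rational coefficients that takes integer values at all integer points is an
integer combination of products of binomial coefficients. -/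
theorem exists_eval_X_eq (P : MvPolynomial σ ℚ)
    (h : ∀ a : σ → ℤ, ∃ z : ℤ, MvPolynomial.eval (fun s => (a s : ℚ)) P = z) :
    ∃ p : BinomialPolynomial σ, p.eval X = P := by
  classical
  have hP : P ∈ Submodule.span ℚ (Set.range (chooseProd (σ := σ))) := by
    rw [span_chooseProd]; trivial
  obtain ⟨q, rfl⟩ := Finsupp.mem_span_range_iff_exists_finsupp.1 hP
  have hev : ∀ m : σ →₀ ℕ, MvPolynomial.eval (fun s => (m s : ℚ))
      (q.sum fun k a => a • chooseProd k) =
        ∑ k ∈ q.support, q k * ∏ s, ((m s).choose (k s) : ℚ) := by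
    intro m
    rw [Finsupp.sum, map_sum]
    exact Finset.sum_congr rfl fun k _ => by rw [MvPolynomial.smul_eval, eval_chooseProd]
  -- The coefficient at `m` is an integer because the value at the point `m` is one, and involves
  -- only this coefficient (with factor `1`) and coefficients at smaller exponents.
  have hq : ∀ m, ∃ z : ℤ, q m = z := by
    intro m
    induction m using WellFoundedLT.induction with
    | ind m ih =>
      obtain ⟨z, hz⟩ := h fun s => (m s : ℤ)
      simp only [Int.cast_natCast] at hz
      have hint : ∀ k, ∃ y : ℤ, k ≠ m → q k * ∏ s, ((m s).choose (k s) : ℚ) = y := by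
        intro k
        by_cases hkm : k ≤ m
        · by_cases he : k = m
          · exact ⟨0, fun h => absurd he h⟩
          · obtain ⟨y, hy⟩ := ih k (lt_of_le_of_ne hkm he)
            refine ⟨y * ∏ s, ((m s).choose (k s) : ℤ), fun _ => ?_⟩
            rw [hy]
            push_cast
            rfl
        · obtain ⟨s, hs⟩ : ∃ s, m s < k s := by
            by_contra! hc
            exact hkm fun s => hc s
          refine ⟨0, fun _ => ?_⟩
          rw [Finset.prod_eq_zero (Finset.mem_univ s), mul_zero, Int.cast_zero]
          rw [Nat.choose_eq_zero_of_lt hs, Nat.cast_zero]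
      choose y hy using hint
      by_cases hm : m ∈ q.support
      · rw [hev, ← Finset.add_sum_erase _ _ hm,
          Finset.sum_congr rfl fun k hk => hy k (Finset.ne_of_mem_erase hk)] at hz
        refine ⟨z - ∑ k ∈ q.support.erase m, y k, ?_⟩
        simp only [Nat.choose_self, Nat.cast_one, Finset.prod_const_one, mul_one] at hz
        push_cast
        rw [← hz, add_sub_cancel_right]
      · exact ⟨0, by simpa using hm⟩
  refine ⟨q.mapRange Rat.num Rat.num_zero, ?_⟩
  refine (Finsupp.sum_mapRange_index (h := fun m z => z • chooseProd m)
    fun _ => zero_smul ℤ _).trans ?_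
  refine Finsupp.sum_congr fun m _ => ?_
  obtain ⟨z, hz⟩ := hq m
  rw [hz, Rat.num_intCast, Int.cast_smul_eq_zsmul]

end BinomialPolynomial

namespace HallBasicSequence

open TruncSeries MvPolynomial

variable {r c : ℕ} [NeZero c] (U : HallBasicSequence r c)

/-! ### Transfer of identities from the integers to binomial rings -/

section Transfer

variable {U} {σ : Type*}

/-- Elements of the Magnus ring with polynomial coefficients are determined by their specializations
at integer points. -/
theorem magnusMap_eval_injective {g g' : U.MagnusRing (MvPolynomial σ ℚ)}
    (h : ∀ a : σ → ℤ, U.magnusMap (MvPolynomial.eval fun s => (a s : ℚ)) g =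
      U.magnusMap (MvPolynomial.eval fun s => (a s : ℚ)) g') : g = g' := by
  refine TruncSeries.ext fun n hn => MonoidAlgebra.coeff_injective (Finsupp.ext fun w => ?_)
  refine MvPolynomial.funext_set (fun _ => Set.range ((↑) : ℤ → ℚ))
    (fun _ => Set.infinite_range_of_injective Int.cast_injective) fun x hx => ?_
  choose a ha using fun s => hx s trivial
  obtain rfl : (fun s => (a s : ℚ)) = x := funext ha
  have := congrArg (fun y : U.MagnusRing ℚ => (TruncSeries.coeff n y).coeff w) (h a)
  simpa [magnusMap, TruncSeries.coeff_map] using this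

/-- If the specializations of `g` at the integer points are formal products, with exponents given by
binomial polynomials, then the same polynomials give the exponents of its specializations at the
points of every binomial ring. -/
theorem magnusMap_eq_magnusForm {g : U.MagnusRing (MvPolynomial σ ℚ)}
    {q : U.Index → BinomialPolynomial σ}
    (h : ∀ a : σ → ℤ, U.magnusMap (MvPolynomial.eval fun s => (a s : ℚ)) g =
      U.magnusForm ℚ fun s => ((q s).eval a : ℤ))
    {R K : Type*} [CommRing R] [BinomialRing R] [CommRing K] [BinomialRing K] [Algebra ℚ K]
    (ρ : R →+* K) (b : σ → R) :
    U.magnusMap (MvPolynomial.aeval fun s => ρ (b s)).toRingHom g =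
      U.magnusForm K fun s => ρ ((q s).eval b) := by
  have hg : g = U.magnusForm (MvPolynomial σ ℚ) fun s => (q s).eval X := by
    refine magnusMap_eval_injective fun a => ?_
    rw [h, magnusMap_magnusForm]
    congr 1
    ext s
    rw [BinomialPolynomial.map_eval, ← eq_intCast (Int.castRingHom ℚ),
      BinomialPolynomial.map_eval]
    simp
  rw [hg, magnusMap_magnusForm]
  congr 1
  ext s
  rw [BinomialPolynomial.map_eval, BinomialPolynomial.map_eval]
  simp

/-- If the specializations of `g` at the integer points are images of elements of the group, the
exponents of these elements are given by binomial polynomials: they are polynomials in the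
coefficients of `g`, and take integer values. -/
theorem exists_binomialPolynomial [Fintype σ] {g : U.MagnusRing (MvPolynomial σ ℚ)}
    (h : ∀ a : σ → ℤ, ∃ x : FreeNilpotentGroup r c,
      U.magnusMap (MvPolynomial.eval fun s => (a s : ℚ)) g = (U.magnus ℚ x : U.MagnusRing ℚ)) :
    ∃ q : U.Index → BinomialPolynomial σ, ∀ a : σ → ℤ,
      U.magnusMap (MvPolynomial.eval fun s => (a s : ℚ)) g =
        U.magnusForm ℚ fun s => ((q s).eval a : ℤ) := by
  have h' : ∀ a : σ → ℤ, ∃ d : U.Index → ℤ,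
      U.magnusMap (MvPolynomial.eval fun s => (a s : ℚ)) g = U.magnusForm ℚ fun s => (d s : ℚ) := by
    intro a
    obtain ⟨x, hx⟩ := h a
    obtain ⟨d, rfl⟩ := exists_normalForm (U := U) x
    exact ⟨d, hx.trans (magnusForm_intCast d).symm⟩
  choose d hd using h'
  have hex : ∀ (a : σ → ℤ) (s : U.Index), MvPolynomial.eval (fun s => (a s : ℚ))
      (U.extract (MvPolynomial σ ℚ) g c s) = d a s := by
    intro a s
    have := congrFun (extract_magnusMap (U := U) (MvPolynomial.eval fun s => (a s : ℚ)) g c) s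
    rw [← this, hd, extract_magnusForm_top]
  choose q hq using fun s => BinomialPolynomial.exists_eval_X_eq
    (U.extract (MvPolynomial σ ℚ) g c s) fun a => ⟨_, hex a s⟩
  refine ⟨q, fun a => ?_⟩
  rw [hd]
  congr 1
  ext s
  rw [← hex, ← hq, BinomialPolynomial.map_eval, ← eq_intCast (Int.castRingHom ℚ),
    BinomialPolynomial.map_eval]
  simp

end Transfer

/-! ### Hall's theorem -/

/-- The product of two generic formal products. -/
def genericMul : U.MagnusRing (MvPolynomial (U.Index ⊕ U.Index) ℚ) :=
  U.magnusForm _ (fun s => X (Sum.inl s)) * U.magnusForm _ fun s => X (Sum.inr s)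

/-- A generic power of a generic formal product. -/
def genericPow : U.MagnusRing (MvPolynomial (Option U.Index) ℚ) :=
  bpow (U.magnusForm _ fun s => X (some s)) (X none : MvPolynomial (Option U.Index) ℚ)

variable {U}

theorem magnusMap_genericMul {K : Type*} [CommRing K] [BinomialRing K]
    (σ : MvPolynomial (U.Index ⊕ U.Index) ℚ →+* K) :
    U.magnusMap σ U.genericMul =
      U.magnusForm K (fun s => σ (X (Sum.inl s))) * U.magnusForm K fun s => σ (X (Sum.inr s)) := by
  rw [genericMul, map_mul, magnusMap_magnusForm, magnusMap_magnusForm]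

theorem magnusMap_genericPow {K : Type*} [CommRing K] [BinomialRing K]
    (σ : MvPolynomial (Option U.Index) ℚ →+* K) :
    U.magnusMap σ U.genericPow =
      bpow (U.magnusForm K fun s => σ (X (some s))) (σ (X none)) := by
  rw [genericPow, magnusMap_bpow, magnusMap_magnusForm]

theorem magnusMap_genericMul_eval (a : U.Index ⊕ U.Index → ℤ) :
    U.magnusMap (MvPolynomial.eval fun s => (a s : ℚ)) U.genericMul =
      (U.magnus ℚ (U.normalForm (fun s => a (Sum.inl s)) * U.normalForm fun s => a (Sum.inr s)) :
        U.MagnusRing ℚ) := by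
  rw [magnusMap_genericMul, map_mul, Units.val_mul, ← magnusForm_intCast, ← magnusForm_intCast]
  simp

/-- Hall's theorem: multiplication of normal forms is given by binomial polynomials. -/
theorem exists_isCanonical : ∃ p, U.IsCanonical p := by
  obtain ⟨q, hq⟩ := exists_binomialPolynomial (U := U) fun a => ⟨_, magnusMap_genericMul_eval a⟩
  refine ⟨q, fun a b => ?_⟩
  obtain ⟨d, hd⟩ := exists_normalForm (U := U) (U.normalForm a * U.normalForm b)
  have h := hq (Sum.elim a b)
  rw [magnusMap_genericMul_eval] at h
  simp only [Sum.elim_inl, Sum.elim_inr] at h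
  rw [← hd, ← magnusForm_intCast] at h
  rw [← hd]
  congr 1
  ext s
  exact_mod_cast congrFun (magnusForm_injective h) s

theorem isCanonical_canonicalPolynomials : U.IsCanonical U.canonicalPolynomials :=
  Classical.epsilon_spec exists_isCanonical

section

variable {R K : Type*} [CommRing R] [BinomialRing R] [CommRing K] [BinomialRing K] [Algebra ℚ K]
  (ρ : R →+* K)

/-- The canonical polynomials describe the product of formal products over every binomial ring. -/
theorem magnusForm_canonicalPolynomials (a b : U.Index → R) :
    (U.magnusForm K fun s => ρ ((U.canonicalPolynomials s).eval (Sum.elim a b))) =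
      U.magnusForm K (fun s => ρ (a s)) * U.magnusForm K fun s => ρ (b s) := by
  rw [← magnusMap_eq_magnusForm (g := U.genericMul) (q := U.canonicalPolynomials) (fun a => ?_) ρ,
    magnusMap_genericMul]
  · simp
  · rw [magnusMap_genericMul_eval, isCanonical_canonicalPolynomials, ← magnusForm_intCast]
    congr 2
    ext s
    congr 2
    ext x
    cases x <;> rfl

/-- Powers of formal products, with exponents in a binomial ring, are formal products. -/
theorem exists_magnusForm_eq_bpow (a : U.Index → R) (l : R) :
    ∃ d : U.Index → R, (U.magnusForm K fun s => ρ (d s)) =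
      bpow (U.magnusForm K fun s => ρ (a s)) (ρ l) := by
  obtain ⟨q, hq⟩ := exists_binomialPolynomial (U := U) (g := U.genericPow)
    fun a => ⟨U.normalForm (fun s => a (some s)) ^ a none, by
      rw [magnusMap_genericPow, map_zpow, ← bpow_intCast (K := ℚ) NeZero.one_le _
        (U.magnus_sub_one_mem (n := 0) trivial), ← magnusForm_intCast]
      simp⟩
  refine ⟨fun s => (q s).eval fun o => o.elim l a, ?_⟩
  rw [← magnusMap_eq_magnusForm hq ρ, magnusMap_genericPow]
  simp

end

end HallBasicSequence

namespace HallBasicSequence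

open TruncSeries

variable {r c : ℕ} [NeZero c] {U : HallBasicSequence r c}

/-! ### Central formal products -/

theorem val_top_add_one : ((⊤ : Fin c) : ℕ) + 1 = c := by
  obtain ⟨d, rfl⟩ : ∃ d, c = d + 1 := ⟨c - 1, (Nat.succ_pred (NeZero.ne c)).symm⟩
  rfl

theorem val_lt_of_ne_top {i : Fin c} (h : i ≠ ⊤) : (i : ℕ) + 1 < c := by
  have h1 := val_top_add_one (c := c)
  have h2 : (i : ℕ) < ((⊤ : Fin c) : ℕ) := lt_top_iff_ne_top.2 h
  omega

section Top

variable {K : Type*} [CommRing K]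

theorem commute_of_sub_one_mem {g h : U.MagnusRing K} (hg : g - 1 ∈ filtration c)
    (hh : h - 1 ∈ filtration 1) : Commute g h := by
  have h1 : (g - 1) * (h - 1) = 0 := eq_zero_of_mem (c.lt_succ_self) (mul_mem hg hh)
  have h2 : (h - 1) * (g - 1) = 0 := eq_zero_of_mem (by omega) (mul_mem hh hg)
  have h3 : g * h - h * g = (g - 1) * (h - 1) - (h - 1) * (g - 1) := by noncomm_ring
  rw [h1, h2, sub_zero] at h3
  exact sub_eq_zero.1 h3

theorem coeff_linearForm (a : Fin (U.n 0) → K) (k : Fin (U.n 0)) :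
    (U.linearForm K a).coeff (FreeMonoid.of k) = a k := by
  classical
  rw [linearForm, MonoidAlgebra.coeff_sum, Finsupp.finsetSum_apply, Finset.sum_eq_single k]
  · simp [letter]
  · intro l _ hl
    simp [letter, FreeMonoid.of_injective.eq_iff, hl]
  · simp

variable [BinomialRing K]

theorem magnusForm_sub_one_mem_of_top {b : U.Index → K} (hb : ∀ s : U.Index, s.1 ≠ ⊤ → b s = 0) :
    U.magnusForm K b - 1 ∈ filtration c := by
  have h := (magnusForm_sub (c - 1) b 0 fun s hs => hb s fun e => by
    have := val_top_add_one (c := c); rw [e] at hs; omega).2.1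
  rwa [magnusForm_zero, Nat.sub_add_cancel NeZero.one_le] at h

theorem magnusForm_add_top (a : U.Index → K) {b : U.Index → K}
    (hb : ∀ s : U.Index, s.1 ≠ ⊤ → b s = 0) :
    U.magnusForm K (a + b) = U.magnusForm K a * U.magnusForm K b := by
  have hb' : ∀ s : U.Index, (s.1 : ℕ) < c - 1 → b s = 0 := fun s hs => hb s fun e => by
    have := val_top_add_one (c := c); rw [e] at hs; omega
  obtain ⟨-, h1, h2⟩ := magnusForm_sub (c - 1) (a + b) a fun s hs => by simp [hb' s hs]
  obtain ⟨-, h3, h4⟩ := magnusForm_sub (c - 1) b 0 hb'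
  rw [Nat.sub_add_cancel NeZero.one_le] at h1 h2 h3 h4
  have key : U.magnusForm K (a + b) - U.magnusForm K a = U.magnusForm K b - U.magnusForm K 0 := by
    refine TruncSeries.ext fun n hn => ?_
    rcases Nat.lt_or_eq_of_le hn with h | rfl
    · rw [h1 n h, h3 n h]
    · rw [h2, h4]
      simp
  have hz : (U.magnusForm K a - 1) * (U.magnusForm K b - 1) = 0 :=
    eq_zero_of_mem (by omega)
      (mul_mem (magnusForm_sub_one_mem a) (magnusForm_sub_one_mem_of_top hb))
  rw [magnusForm_zero] at key
  have e : U.magnusForm K a * U.magnusForm K b = (U.magnusForm K a - 1) * (U.magnusForm K b - 1) +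
      (U.magnusForm K b - 1) + U.magnusForm K a := by noncomm_ring
  rw [e, hz, zero_add, ← key, sub_add_cancel]

theorem coeff_one_magnusForm (a : U.Index → K) :
    coeff 1 (U.magnusForm K a - 1) = U.linearForm K fun k => a ⟨0, k⟩ := by
  have h := (magnusForm_sub 0 a 0 fun s hs => absurd hs (Nat.not_lt_zero _)).2.2
  rw [magnusForm_zero] at h
  rw [h, Fintype.sum_sigma, Finset.sum_eq_single 0]
  · refine Finset.sum_congr rfl fun k _ => ?_
    have hu := gradedClass_u (U := U) ⟨0, k⟩
    rw [Fin.coe_ofNat_eq_mod, Nat.zero_mod] at hu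
    rw [if_pos (by simp), leading_zero, hu, Pi.zero_apply, sub_zero]
    congr 1
    rw [linearForm, Finset.sum_eq_single k]
    · simp
    · intro l _ hl
      rw [Pi.single_eq_of_ne (by simpa using hl), Int.cast_zero, zero_smul]
    · simp
  · intro i _ hi
    have : (i : ℕ) ≠ 0 := fun e => hi (Fin.ext (by simpa using e))
    exact Finset.sum_eq_zero fun j _ => if_neg this
  · simp

end Top

/-! ### The group structure of a deformation -/

namespace Deformation

variable {R : Type*} [CommRing R] {f : Fin (U.n 0) → R → R → Fin (U.n ⊤) → R}

/-- The exponents of weight one. -/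
def weightOne (x : U.Deformation f) : Fin (U.n 0) → R := fun k => x.exponents ⟨0, k⟩

variable (f) in
/-- The exponents of the central factor by which the product of a deformation differs from the
product of formal products. -/
def twist (v w : Fin (U.n 0) → R) : U.Index → R :=
  ∑ j : Fin (U.n ⊤), Pi.single (⟨⊤, j⟩ : U.Index) (∑ k, f k (v k) (w k) j)

theorem twist_of_ne (v w : Fin (U.n 0) → R) (s : U.Index) (hs : s.1 ≠ ⊤) : twist f v w s = 0 := by
  rw [twist, Finset.sum_apply]
  exact Finset.sum_eq_zero fun j _ => Pi.single_eq_of_ne (fun e => hs (by rw [e])) _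

theorem twist_top (v w : Fin (U.n 0) → R) (j : Fin (U.n ⊤)) :
    twist f v w ⟨⊤, j⟩ = ∑ k, f k (v k) (w k) j := by
  rw [twist, Finset.sum_apply, Finset.sum_eq_single j, Pi.single_eq_same]
  · intro i _ hi
    exact Pi.single_eq_of_ne (fun e => hi (by simpa using e.symm)) _
  · simp

instance : One (U.Deformation f) := ⟨⟨0⟩⟩

theorem weightOne_one : (1 : U.Deformation f).weightOne = 0 := rfl

theorem weightOne_mk_add [hc : Fact (2 ≤ c)] (a : U.Index → R) {b : U.Index → R}
    (hb : ∀ s : U.Index, s.1 ≠ ⊤ → b s = 0) :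
    (⟨a + b⟩ : U.Deformation f).weightOne = (⟨a⟩ : U.Deformation f).weightOne := by
  have h0 : (0 : Fin c) ≠ ⊤ := fun e => by
    have h1 := val_top_add_one (c := c)
    have h2 : (2 : ℕ) ≤ c := hc.out
    rw [← e, Fin.coe_ofNat_eq_mod, Nat.zero_mod] at h1
    omega
  ext k
  change a ⟨0, k⟩ + b ⟨0, k⟩ = a ⟨0, k⟩
  rw [hb ⟨0, k⟩ h0, add_zero]

section Cocycle

variable [hf : Fact (∀ k, IsSymmetricTwoCocycle (f k))]

theorem twist_zero_left (v : Fin (U.n 0) → R) : twist f 0 v = 0 := by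
  simp [twist, (hf.out _).zero_left]

theorem twist_comm (v w : Fin (U.n 0) → R) : twist f v w = twist f w v := by
  simp only [twist, (hf.out _).symm (v _) (w _)]

theorem twist_cocycle (v w z : Fin (U.n 0) → R) :
    twist f (v + w) z + twist f v w = twist f v (w + z) + twist f w z := by
  simp only [twist, ← Finset.sum_add_distrib, ← Pi.single_add]
  refine Finset.sum_congr rfl fun j _ => ?_
  congr 1
  refine Finset.sum_congr rfl fun k _ => ?_
  exact congrFun ((hf.out k).cocycle (v k) (w k) (z k)) j

end Cocycle

variable [IsDomain R] [CharZero R]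

/-- The image of a formal product in the Magnus ring over the field of fractions. -/
def embed (x : U.Deformation f) : U.MagnusRing (FractionRing R) :=
  U.magnusForm (FractionRing R) fun s => algebraMap R (FractionRing R) (x.exponents s)

theorem embed_injective : Function.Injective (embed : U.Deformation f → _) := fun x y h => by
  ext s
  exact IsFractionRing.injective R (FractionRing R) (congrFun (magnusForm_injective h) s)

theorem embed_sub_one_mem (x : U.Deformation f) : x.embed - 1 ∈ filtration 1 :=
  magnusForm_sub_one_mem _

theorem coeff_one_embed (x : U.Deformation f) : coeff 1 (x.embed - 1) =
    U.linearForm (FractionRing R) fun k => algebraMap R (FractionRing R) (x.weightOne k) :=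
  coeff_one_magnusForm _

theorem embed_one : (1 : U.Deformation f).embed = 1 := by
  change (U.magnusForm (FractionRing R) fun _ => algebraMap R (FractionRing R) 0) = 1
  rw [map_zero]
  exact magnusForm_zero

theorem embed_mk_add (a : U.Index → R) {b : U.Index → R} (hb : ∀ s : U.Index, s.1 ≠ ⊤ → b s = 0) :
    (⟨a + b⟩ : U.Deformation f).embed = (⟨a⟩ : U.Deformation f).embed *
      (⟨b⟩ : U.Deformation f).embed := by
  have h := magnusForm_add_top (U := U) (fun s => algebraMap R (FractionRing R) (a s))
    (b := fun s => algebraMap R (FractionRing R) (b s)) fun s hs => by rw [hb s hs, map_zero]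
  rw [embed, embed, embed, ← h]
  congr 1
  ext s
  exact map_add _ _ _

variable (f) in
/-- The image in the Magnus ring of the central factor `twist f v w`. -/
def twistUnit (v w : Fin (U.n 0) → R) : U.MagnusRing (FractionRing R) :=
  (⟨twist f v w⟩ : U.Deformation f).embed

theorem twistUnit_sub_one_mem (v w : Fin (U.n 0) → R) : twistUnit f v w - 1 ∈ filtration c :=
  magnusForm_sub_one_mem_of_top (b := fun s => algebraMap R (FractionRing R) (twist f v w s))
    fun s hs => by rw [twist_of_ne v w s hs, map_zero]

theorem twistUnit_commute (v w : Fin (U.n 0) → R) (x : U.Deformation f) :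
    Commute (twistUnit f v w) x.embed :=
  commute_of_sub_one_mem (twistUnit_sub_one_mem v w) (embed_sub_one_mem x)

theorem twistUnit_mul (v w v' w' : Fin (U.n 0) → R) :
    twistUnit f v w * twistUnit f v' w' =
      (⟨twist f v w + twist f v' w'⟩ : U.Deformation f).embed :=
  (embed_mk_add _ (twist_of_ne v' w')).symm

theorem twistUnit_zero_left [Fact (∀ k, IsSymmetricTwoCocycle (f k))]
    (v : Fin (U.n 0) → R) : twistUnit f 0 v = 1 := by
  rw [twistUnit, twist_zero_left]
  exact embed_one

variable [BinomialRing R]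

theorem embed_mul (x y : U.Deformation f) :
    (x * y).embed = x.embed * y.embed * twistUnit f x.weightOne y.weightOne := by
  refine (embed_mk_add (fun s => (U.canonicalPolynomials s).eval (Sum.elim x.exponents y.exponents))
    (twist_of_ne x.weightOne y.weightOne)).trans ?_
  congr 1
  exact magnusForm_canonicalPolynomials (algebraMap R (FractionRing R)) _ _

protected theorem one_mul [Fact (∀ k, IsSymmetricTwoCocycle (f k))]
    (x : U.Deformation f) : 1 * x = x := by
  refine embed_injective ?_
  rw [embed_mul, weightOne_one, twistUnit_zero_left, embed_one, one_mul, mul_one]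

section

variable [hc : Fact (2 ≤ c)]

theorem weightOne_mul (x y : U.Deformation f) :
    (x * y).weightOne = x.weightOne + y.weightOne := by
  have h2 : (2 : ℕ) ≤ c := hc.out
  have e : (x * y).embed - 1 = (x.embed - 1) * (y.embed * twistUnit f x.weightOne y.weightOne) +
      (y.embed - 1) * twistUnit f x.weightOne y.weightOne +
      (twistUnit f x.weightOne y.weightOne - 1) := by
    rw [embed_mul]
    noncomm_ring
  have ht := twistUnit_sub_one_mem (f := f) x.weightOne y.weightOne
  have ht1 := filtration_anti (by omega : 1 ≤ c) ht
  have h := coeff_one_embed (x * y)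
  rw [e, map_add, map_add, coeff_mul_unipotent (embed_sub_one_mem x)
    (mul_sub_one_mem (embed_sub_one_mem y) ht1), coeff_mul_unipotent (embed_sub_one_mem y) ht1,
    ht 1 (by omega), add_zero, coeff_one_embed, coeff_one_embed] at h
  ext k
  have := congrArg (fun ξ => ξ.coeff (FreeMonoid.of k)) h
  simp only [MonoidAlgebra.coeff_add, Finsupp.add_apply, coeff_linearForm] at this
  rw [← map_add] at this
  exact (IsFractionRing.injective R (FractionRing R) this).symm

protected theorem exists_left_inv (x : U.Deformation f) : ∃ y : U.Deformation f, y * x = 1 := by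
  obtain ⟨b, hb⟩ := exists_magnusForm_eq_bpow (algebraMap R (FractionRing R)) x.exponents (-1)
  let y : U.Deformation f := ⟨b⟩
  have hy : y.embed = bpow x.embed (algebraMap R (FractionRing R) (-1)) := hb
  have ht : ∀ s : U.Index, s.1 ≠ ⊤ → (-twist f y.weightOne x.weightOne) s = 0 := fun s hs => by
    rw [Pi.neg_apply, twist_of_ne _ _ s hs, neg_zero]
  refine ⟨⟨b + -twist f y.weightOne x.weightOne⟩, embed_injective ?_⟩
  rw [embed_mul, weightOne_mk_add _ ht, embed_mk_add _ ht]
  have hx : x.embed = bpow x.embed (1 : FractionRing R) := (bpow_one NeZero.one_le _).symm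
  have h1 : y.embed * x.embed = 1 := by
    rw [hy]
    nth_rw 2 [hx]
    rw [← bpow_add (embed_sub_one_mem x), map_neg, map_one, neg_add_cancel, bpow_zero]
  have h2 : (⟨-twist f y.weightOne x.weightOne⟩ : U.Deformation f).embed * x.embed =
      x.embed * (⟨-twist f y.weightOne x.weightOne⟩ : U.Deformation f).embed :=
    (commute_of_sub_one_mem (magnusForm_sub_one_mem_of_top
      (b := fun s => algebraMap R (FractionRing R) ((-twist f y.weightOne x.weightOne) s))
      fun s hs => by rw [ht s hs, map_zero]) (embed_sub_one_mem x)).eq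
  rw [mul_assoc (embed ⟨b⟩), h2, ← mul_assoc (embed ⟨b⟩)]
  change y.embed * x.embed * _ * _ = _
  rw [h1, one_mul, twistUnit, ← embed_mk_add _ (twist_of_ne _ _), neg_add_cancel]
  rfl

variable [hf : Fact (∀ k, IsSymmetricTwoCocycle (f k))]

protected theorem mul_assoc (x y z : U.Deformation f) : x * y * z = x * (y * z) := by
  refine embed_injective ?_
  rw [embed_mul, embed_mul, embed_mul, embed_mul, weightOne_mul, weightOne_mul]
  have h1 := (twistUnit_commute x.weightOne y.weightOne z).eq
  have h2 : twistUnit f x.weightOne y.weightOne *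
      twistUnit f (x.weightOne + y.weightOne) z.weightOne = twistUnit f y.weightOne z.weightOne *
        twistUnit f x.weightOne (y.weightOne + z.weightOne) := by
    rw [twistUnit_mul, twistUnit_mul, add_comm, twist_cocycle, add_comm]
  rw [mul_assoc (x.embed * y.embed), h1, ← mul_assoc (x.embed * y.embed),
    mul_assoc _ _ (twistUnit f _ _), h2]
  simp only [mul_assoc]

instance : Inv (U.Deformation f) := ⟨fun x => (Deformation.exists_left_inv x).choose⟩

instance : Group (U.Deformation f) :=
  Group.ofLeftAxioms Deformation.mul_assoc Deformation.one_mul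
    fun x => (Deformation.exists_left_inv x).choose_spec

theorem weightOne_commutator (x y : U.Deformation f) : ⁅x, y⁆.weightOne = 0 := by
  have h : ⁅x, y⁆ * (y * x) = x * y := by rw [commutatorElement_def]; group
  have := congrArg weightOne h
  rw [weightOne_mul, weightOne_mul, weightOne_mul, add_comm y.weightOne] at this
  exact add_eq_right.1 this

/-- Commutators are not affected by the deformation. -/
theorem embed_commutator (x y : U.Deformation f) :
    ⁅x, y⁆.embed * (y.embed * x.embed) = x.embed * y.embed := by
  have h : ⁅x, y⁆ * (y * x) = x * y := by rw [commutatorElement_def]; group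
  have h1 := congrArg embed h
  rw [embed_mul, embed_mul, embed_mul, weightOne_commutator, twistUnit_zero_left, mul_one,
    twistUnit, twist_comm, ← twistUnit, ← mul_assoc] at h1
  refine (isUnit_of_sub_one_mem (filtration_anti NeZero.one_le
    (twistUnit_sub_one_mem (f := f) x.weightOne y.weightOne))).mul_right_cancel h1

end

end Deformation

/-- The group `N_{r,c}(R)` is the deformation by zero. -/
def completionEquiv {R : Type*} [CommRing R] [BinomialRing R] :
    U.Completion R ≃* U.Deformation (0 : Fin (U.n 0) → R → R → Fin (U.n ⊤) → R) where
  toFun x := ⟨x.exponents⟩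
  invFun x := ⟨x.exponents⟩
  left_inv _ := rfl
  right_inv _ := rfl
  map_mul' x y := by
    ext s
    obtain ⟨i, j⟩ := s
    by_cases h : i = ⊤
    · subst h
      rw [Deformation.mul_exponents_top]
      simp only [Pi.zero_apply, Finset.sum_const_zero, add_zero]
      rfl
    · rw [Deformation.mul_exponents_of_ne _ _ _ _ h]
      rfl

end HallBasicSequence

namespace HallBasicSequence

open TruncSeries

variable {r c : ℕ} [NeZero c] {U : HallBasicSequence r c}

/-! ### Words and letters -/

section Words

variable {K : Type*} [CommRing K]

theorem coeff_mul_letter (ξ : U.WordAlgebra K) (w : FreeMonoid (Fin (U.n 0))) (k : Fin (U.n 0)) :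
    (ξ * U.letter K k).coeff (w * FreeMonoid.of k) = ξ.coeff w := by
  rw [letter, MonoidAlgebra.coeff_mul_single_mul, mul_one]

theorem coeff_letter_mul (ξ : U.WordAlgebra K) (w : FreeMonoid (Fin (U.n 0))) (k : Fin (U.n 0)) :
    (U.letter K k * ξ).coeff (FreeMonoid.of k * w) = ξ.coeff w := by
  rw [letter, MonoidAlgebra.coeff_single_mul_mul, one_mul]

theorem coeff_letter_mul_of_ne (ξ : U.WordAlgebra K) (w : FreeMonoid (Fin (U.n 0)))
    {j k : Fin (U.n 0)} (h : j ≠ k) : (U.letter K k * ξ).coeff (FreeMonoid.of j * w) = 0 :=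
  MonoidAlgebra.coeff_single_mul_of_forall_mul_ne _ _ fun d e => by
    have := congrArg FreeMonoid.toList e
    simp only [FreeMonoid.toList_mul, FreeMonoid.toList_of, List.singleton_append,
      List.cons.injEq] at this
    exact h this.1.symm

theorem coeff_linearForm_mul_linearForm (a b : Fin (U.n 0) → K) (i j : Fin (U.n 0)) :
    (U.linearForm K a * U.linearForm K b).coeff (FreeMonoid.of i * FreeMonoid.of j) =
      a i * b j := by
  rw [linearForm, Finset.sum_mul, MonoidAlgebra.coeff_sum, Finsupp.finsetSum_apply,
    Finset.sum_eq_single i]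
  · rw [smul_mul_assoc, MonoidAlgebra.coeff_smul, Finsupp.smul_apply, coeff_letter_mul,
      coeff_linearForm, smul_eq_mul]
  · intro k _ hk
    rw [smul_mul_assoc, MonoidAlgebra.coeff_smul, Finsupp.smul_apply,
      coeff_letter_mul_of_ne _ _ hk.symm, smul_zero]
  · simp

/-- An element of the free associative algebra that commutes with a letter is a polynomial in this
letter. -/
theorem exists_eq_pow_of_commute_letter {ξ : U.WordAlgebra K} {k : Fin (U.n 0)}
    (h : Commute ξ (U.letter K k)) (w : FreeMonoid (Fin (U.n 0))) (hw : ξ.coeff w ≠ 0) :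
    ∃ m, w = FreeMonoid.of k ^ m := by
  have key : ∀ (w : FreeMonoid (Fin (U.n 0))) (m : ℕ), ξ.coeff (w * FreeMonoid.of k ^ m) ≠ 0 →
      ∃ m, w = FreeMonoid.of k ^ m := by
    intro w
    induction w using FreeMonoid.inductionOn' with
    | one => exact fun _ _ => ⟨0, rfl⟩
    | of_mul j w ih =>
      intro m hm
      rw [← coeff_mul_letter, h.eq, mul_assoc (FreeMonoid.of j), mul_assoc (FreeMonoid.of j)] at hm
      by_cases hj : j = k
      · subst hj
        rw [coeff_letter_mul, mul_assoc, ← pow_succ] at hm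
        obtain ⟨m', rfl⟩ := ih _ hm
        exact ⟨m' + 1, (pow_succ' _ _).symm⟩
      · exact absurd (coeff_letter_mul_of_ne _ _ hj) hm
  exact key w 0 (by rwa [pow_zero, mul_one])

/-- In the free Lie algebra only the multiples of a letter commute with this letter. -/
theorem adAction_eq_zero_of_commute_letter {ξ : U.WordAlgebra K} {k : Fin (U.n 0)}
    (h : Commute ξ (U.letter K k)) (t : U.Index) (ht : (t.1 : ℕ) ≠ 0) :
    U.adAction K ξ none (some t) = 0 := by
  have hpow : ∀ m, (U.adMatrix K k ^ m) none (some t) = 0 := by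
    have h1 : Matrix.vecMul (Pi.single none 1) (U.adMatrix K k) =
        U.castVec K (U.gradedClass 0 (U.u 0 k)) := by
      have hu := gradedClass_u (U := U) ⟨0, k⟩
      rw [Fin.coe_ofNat_eq_mod, Nat.zero_mod] at hu
      rw [hu, Matrix.single_one_vecMul]
      rfl
    have h2 : Matrix.vecMul (Pi.single none 1) (U.adMatrix K k ^ 2) = 0 := by
      rw [pow_two, ← Matrix.vecMul_vecMul, h1, castVec_gradedClass_vecMul_adMatrix (i := 0) trivial,
        commutatorElement_self, gradedClass_one, castVec_zero]
    intro m
    match m with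
    | 0 => simp
    | 1 =>
      rw [pow_one]
      rw [Matrix.single_one_vecMul] at h1
      refine (congrFun h1 (some t)).trans ?_
      change ((if (t.1 : ℕ) = 0 then _ else 0 : ℤ) : K) = 0
      rw [if_neg ht, Int.cast_zero]
    | m + 2 =>
      have h3 : Matrix.vecMul (Pi.single none 1) (U.adMatrix K k ^ (m + 2)) = 0 := by
        rw [add_comm, pow_add, ← Matrix.vecMul_vecMul, h2, Matrix.zero_vecMul]
      rw [Matrix.single_one_vecMul] at h3
      exact congrFun h3 (some t)
  rw [adAction, MonoidAlgebra.lift_apply, Finsupp.sum, Matrix.sum_apply]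
  refine Finset.sum_eq_zero fun w hw => ?_
  obtain ⟨m, rfl⟩ := exists_eq_pow_of_commute_letter h w (Finsupp.mem_support_iff.1 hw)
  rw [map_pow (FreeMonoid.lift (U.adMatrix K)), FreeMonoid.lift_eval_of]
  exact (congrArg _ (hpow m)).trans (mul_zero _)

end Words

/-! ### The number of generators -/

/-- There are at least two terms of weight one. -/
theorem nontrivial_weightOne (hr : 2 ≤ r) : Nontrivial (Fin (U.n 0)) := by
  by_contra hn
  rw [not_nontrivial_iff_subsingleton] at hn
  let χ (l : Fin r) : FreeNilpotentGroup r c →* Multiplicative ℤ :=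
    QuotientGroup.lift _ (FreeGroup.lift fun m => Multiplicative.ofAdd (if m = l then 1 else 0))
      fun x hx => by
        have h1 : x ∈ lcs (FreeGroup (Fin r)) 1 := lcs_anti NeZero.one_le hx
        exact Abelianization.commutator_subset_ker _ h1
  have hχ : ∀ l m, (χ l (QuotientGroup.mk (FreeGroup.of m))).toAdd = if m = l then 1 else 0 :=
    fun l m => congrArg Multiplicative.toAdd (FreeGroup.lift_apply_of ..)
  have hsum : ∀ l x, (χ l x).toAdd = ∑ j, U.gradedClass 0 x ⟨0, j⟩ * (χ l (U.u 0 j)).toAdd := by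
    intro l x
    have h1 := eq_sum_gradedClass_smul (U := U) (n := 0) (fun x => (χ l x).toAdd)
      (fun x _ y _ => by simp) (fun x hx => by
        have h1 : x ∈ (χ l).ker := Abelianization.commutator_subset_ker (χ l) hx
        rw [MonoidHom.mem_ker] at h1
        simp [h1]) (x := x) trivial
    have h2 := sum_gradedClass_smul (K := ℤ) (U := U) 0 x fun s => (χ l (U.u s.1 s.2)).toAdd
    rw [Fin.coe_ofNat_eq_mod, Nat.zero_mod] at h2
    exact h1.trans h2
  have hswap : ∀ l m x y, (χ l x).toAdd * (χ m y).toAdd = (χ l y).toAdd * (χ m x).toAdd := by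
    intro l m x y
    rw [hsum, hsum, hsum, hsum, Finset.sum_mul_sum, Finset.sum_mul_sum]
    refine Finset.sum_congr rfl fun i _ => Finset.sum_congr rfl fun j _ => ?_
    rw [Subsingleton.elim i j]
    ring
  have := hswap ⟨0, by omega⟩ ⟨1, by omega⟩ (QuotientGroup.mk (FreeGroup.of ⟨0, by omega⟩))
    (QuotientGroup.mk (FreeGroup.of ⟨1, by omega⟩))
  simp [hχ] at this

/-! ### Iterated commutators -/

/-- The left-normed commutator `[x, z, …, z]`, in which `z` occurs `n` times, formed with
`⁅x, z⁆ = x * z * x⁻¹ * z⁻¹`. -/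
def engel {G : Type*} [Group G] : ℕ → G → G → G
  | 0, x, _ => x
  | n + 1, x, z => ⁅engel n x z, z⁆

theorem map_engel {G H F : Type*} [Group G] [Group H] [FunLike F G H] [MonoidHomClass F G H]
    (φ : F) (n : ℕ) (x z : G) : φ (engel n x z) = engel n (φ x) (φ z) := by
  induction n with
  | zero => rfl
  | succ n ih => rw [engel, engel, map_commutatorElement, ih]

/-! ### Formal powers of the terms of weight one -/

theorem magnusForm_single {K : Type*} [CommRing K] [BinomialRing K] (s : U.Index) (l : K) :
    U.magnusForm K (Pi.single s l) = bpow (U.magnus K (U.u s.1 s.2) : U.MagnusRing K) l := by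
  have h1 : ∀ i, i ≠ s.1 → (List.ofFn fun j : Fin (U.n i) =>
      bpow (U.magnus K (U.u i j) : U.MagnusRing K) ((Pi.single s l : U.Index → K) ⟨i, j⟩)).prod =
        1 := by
    intro i hi
    have : ∀ j, (Pi.single s l : U.Index → K) ⟨i, j⟩ = 0 :=
      fun j => Pi.single_eq_of_ne (fun e => hi (by rw [← e])) _
    simp [this, bpow_zero, List.ofFn_const]
  have h2 : ∀ j, j ≠ s.2 → (Pi.single s l : U.Index → K) ⟨s.1, j⟩ = 0 :=
    fun j hj => Pi.single_eq_of_ne (fun e => hj (by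
      rw [Sigma.ext_iff] at e
      exact eq_of_heq e.2)) _
  rw [magnusForm, List.prod_ofFn_of_eq_one s.1 (fun _ => 1) _ (fun _ _ => rfl) h1,
    List.prod_ofFn_of_eq_one s.2 (fun _ => 1) _ (fun _ _ => rfl)
      fun j hj => by rw [h2 j hj, bpow_zero]]
  simp [List.ofFn_const]

namespace Deformation

variable {R : Type*} [CommRing R] {f : Fin (U.n 0) → R → R → Fin (U.n ⊤) → R}

variable (f) in
/-- The formal power `u_{1k}^a`. -/
def single (k : Fin (U.n 0)) (a : R) : U.Deformation f := ⟨Pi.single ⟨0, k⟩ a⟩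

theorem weightOne_single (k : Fin (U.n 0)) (a : R) : (single f k a).weightOne = Pi.single k a := by
  ext j
  by_cases h : j = k
  · subst h
    simp [weightOne, single]
  · rw [Pi.single_eq_of_ne h]
    exact Pi.single_eq_of_ne (fun e => h (by simpa using e)) _

theorem weightOne_surjective (v : Fin (U.n 0) → R) : ∃ x : U.Deformation f, x.weightOne = v := by
  refine ⟨⟨∑ k, Pi.single ⟨0, k⟩ (v k)⟩, ?_⟩
  ext k
  change (∑ k, Pi.single (⟨0, k⟩ : U.Index) (v k) : U.Index → R) ⟨0, k⟩ = v k
  rw [Finset.sum_apply, Finset.sum_eq_single k, Pi.single_eq_same]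
  · intro j _ hj
    exact Pi.single_eq_of_ne (fun e => hj (by simpa using e.symm)) _
  · simp

variable [IsDomain R] [CharZero R]

/-! ### Leading coefficients of iterated commutators -/

theorem embed_sub_one_mem_two {x : U.Deformation f} (hx : x.weightOne = 0) :
    x.embed - 1 ∈ filtration 2 := by
  refine mem_filtration_succ.2 ⟨x.embed_sub_one_mem, ?_⟩
  rw [coeff_one_embed, hx]
  simp [linearForm]

theorem coeff_one_embed_single (k : Fin (U.n 0)) :
    coeff 1 ((single f k 1).embed - 1) = U.letter (FractionRing R) k := by
  rw [coeff_one_embed, weightOne_single, linearForm, Finset.sum_eq_single k]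
  · rw [Pi.single_eq_same, map_one, one_smul]
  · intro l _ hl
    rw [Pi.single_eq_of_ne hl, map_zero, zero_smul]
  · simp

theorem embed_single (k : Fin (U.n 0)) (a : R) : (single f k a).embed =
    bpow (U.magnus (FractionRing R) (U.u 0 k) : U.MagnusRing (FractionRing R))
      (algebraMap R (FractionRing R) a) := by
  rw [← magnusForm_single ⟨0, k⟩, embed]
  congr 1
  ext s
  by_cases h : s = ⟨0, k⟩
  · subst h
    simp [single]
  · rw [Pi.single_eq_of_ne h]
    exact (congrArg _ (Pi.single_eq_of_ne h _)).trans (map_zero _)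

theorem embed_single_add (k : Fin (U.n 0)) (a b : R) :
    (single f k (a + b)).embed = (single f k a).embed * (single f k b).embed := by
  rw [embed_single, embed_single, embed_single, map_add,
    bpow_add (U.magnus_sub_one_mem (n := 0) trivial)]

theorem eq_one_of_embed_sub_one_mem {i : ℕ} (hi : c < i) {x : U.Deformation f}
    (hx : x.embed - 1 ∈ filtration i) : x = 1 :=
  embed_injective (by rw [embed_one]; exact sub_eq_zero.1 (eq_zero_of_mem hi hx))

theorem coeff_embed_one (n : ℕ) : coeff n ((1 : U.Deformation f).embed - 1) = 0 := by
  rw [embed_one, sub_self, map_zero]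

section

variable [BinomialRing R] [hc : Fact (2 ≤ c)] [hf : Fact (∀ k, IsSymmetricTwoCocycle (f k))]

theorem embed_commutator_sub_one_mem {i j : ℕ} {x z : U.Deformation f}
    (hx : x.embed - 1 ∈ filtration i) (hz : z.embed - 1 ∈ filtration j) :
    ⁅x, z⁆.embed - 1 ∈ filtration (i + j) :=
  commutator_sub_one_mem hx hz
    (isUnit_of_sub_one_mem (mul_sub_one_mem z.embed_sub_one_mem x.embed_sub_one_mem))
    (embed_commutator x z)

theorem coeff_embed_commutator {i j : ℕ} (hij : i + j ≤ c) {x z : U.Deformation f}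
    (hx : x.embed - 1 ∈ filtration i) (hz : z.embed - 1 ∈ filtration j) :
    coeff (i + j) (⁅x, z⁆.embed - 1) = coeff i (x.embed - 1) * coeff j (z.embed - 1) -
      coeff j (z.embed - 1) * coeff i (x.embed - 1) :=
  coeff_commutator hij hx hz (mul_sub_one_mem z.embed_sub_one_mem x.embed_sub_one_mem)
    (embed_commutator x z)

theorem embed_engel_sub_one_mem {i : ℕ} {x : U.Deformation f} (hx : x.embed - 1 ∈ filtration i)
    (n : ℕ) (z : U.Deformation f) : (engel n x z).embed - 1 ∈ filtration (i + n) := by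
  induction n with
  | zero => exact hx
  | succ n ih => exact embed_commutator_sub_one_mem (i := i + n) ih z.embed_sub_one_mem

/-- The leading coefficient of `x` can be read off from that of `[x, u_{1k}, …, u_{1k}]`, except at
words that start with `X_k`: bracketing with `X_k` contributes a letter `X_k` at the left or at the
right, and only the latter matters for a word that starts with another letter. -/
theorem coeff_embed_engel_single {i : ℕ} {x : U.Deformation f} (hx : x.embed - 1 ∈ filtration i)
    {j k : Fin (U.n 0)} (hjk : j ≠ k) (w : FreeMonoid (Fin (U.n 0))) (n : ℕ) (hn : i + n ≤ c) :
    (coeff (i + n) ((engel n x (single f k 1)).embed - 1)).coeff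
        (FreeMonoid.of j * w * FreeMonoid.of k ^ n) =
      (coeff i (x.embed - 1)).coeff (FreeMonoid.of j * w) := by
  induction n with
  | zero => rw [pow_zero, mul_one]; rfl
  | succ n ih =>
    have h := coeff_embed_commutator (i := i + n) (j := 1) (x := engel n x (single f k 1))
      (z := single f k 1) hn
      (embed_engel_sub_one_mem hx n _) (embed_sub_one_mem _)
    rw [engel, ← add_assoc, h, coeff_one_embed_single, MonoidAlgebra.coeff_sub, Finsupp.sub_apply,
      pow_succ, ← mul_assoc, coeff_mul_letter, ih (by omega), mul_assoc (FreeMonoid.of j),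
      mul_assoc (FreeMonoid.of j), coeff_letter_mul_of_ne _ _ hjk, sub_zero]

/-- The elements without exponents of weight one are characterized by an Engel condition. -/
theorem weightOne_eq_zero_iff [hn : Nontrivial (Fin (U.n 0))] {x : U.Deformation f} :
    x.weightOne = 0 ↔ ∀ z, engel (c - 1) x z = 1 := by
  have h2 : 2 ≤ c := hc.out
  refine ⟨fun h z => ?_, fun h => ?_⟩
  · exact eq_one_of_embed_sub_one_mem (by omega)
      (embed_engel_sub_one_mem (embed_sub_one_mem_two h) (c - 1) z)
  · ext j
    obtain ⟨k, hk⟩ := exists_ne j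
    have h1 := coeff_embed_engel_single x.embed_sub_one_mem hk.symm 1 (c - 1) (by omega)
    rw [h, coeff_embed_one, MonoidAlgebra.coeff_zero, Finsupp.zero_apply, mul_one, coeff_one_embed,
      coeff_linearForm] at h1
    exact (map_eq_zero_iff _ (IsFractionRing.injective R (FractionRing R))).1 h1.symm

/-- Two elements whose exponents of weight one are proportional are characterized by an Engel
condition on their commutator. -/
theorem weightOne_minors_iff {x y : U.Deformation f} :
    (∀ i j, x.weightOne i * y.weightOne j = x.weightOne j * y.weightOne i) ↔
      ∀ z, engel (c - 2) ⁅x, y⁆ z = 1 := by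
  have h2 : 2 ≤ c := hc.out
  have hm := embed_commutator_sub_one_mem x.embed_sub_one_mem y.embed_sub_one_mem
  have hq := coeff_embed_commutator (by omega) x.embed_sub_one_mem y.embed_sub_one_mem
  rw [coeff_one_embed, coeff_one_embed] at hq
  refine ⟨fun h z => ?_, fun h i j => ?_⟩
  · have h3 : ⁅x, y⁆.embed - 1 ∈ filtration 3 := by
      refine mem_filtration_succ.2 ⟨hm, hq.trans ?_⟩
      rw [sub_eq_zero]
      simp only [linearForm, Finset.sum_mul_sum, smul_mul_smul_comm]
      refine Finset.sum_congr rfl fun i _ => Finset.sum_congr rfl fun j _ => ?_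
      rw [← map_mul, ← map_mul, h i j, mul_comm]
    exact eq_one_of_embed_sub_one_mem (by omega) (embed_engel_sub_one_mem h3 (c - 2) z)
  · by_cases hij : i = j
    · subst hij
      rfl
    have h1 := coeff_embed_engel_single hm hij (FreeMonoid.of j) (c - 2) (by omega)
    rw [h, coeff_embed_one, MonoidAlgebra.coeff_zero, Finsupp.zero_apply, hq,
      MonoidAlgebra.coeff_sub, Finsupp.sub_apply, coeff_linearForm_mul_linearForm,
      coeff_linearForm_mul_linearForm, ← map_mul, ← map_mul, ← map_sub] at h1
    have h4 := (map_eq_zero_iff _ (IsFractionRing.injective R (FractionRing R))).1 h1.symm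
    rw [sub_eq_zero.1 h4, mul_comm]

/-- The centralizer of `u_{1k}` meets the subgroup of elements without exponents of weight one in
the elements that have only exponents of the top weight. -/
theorem exponents_eq_zero_of_commute {x : U.Deformation f} {k : Fin (U.n 0)}
    (hx : Commute x (single f k 1)) (h0 : x.weightOne = 0) (s : U.Index) (hs : s.1 ≠ ⊤) :
    x.exponents s = 0 := by
  have key : ∀ n, n + 1 ≤ c → ∀ s : U.Index, (s.1 : ℕ) < n → x.exponents s = 0 := by
    intro n
    induction n with
    | zero => exact fun _ s hs => absurd hs (Nat.not_lt_zero _)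
    | succ n ih =>
      intro hn s hs
      rcases Nat.lt_succ_iff_lt_or_eq.1 hs with h | h
      · exact ih (by omega) s h
      rcases Nat.eq_zero_or_pos n with rfl | hpos
      · obtain ⟨i, j⟩ := s
        obtain rfl : i = 0 := Fin.ext (by simpa using h)
        exact congrFun h0 j
      have ha : ∀ s : U.Index, (s.1 : ℕ) < n →
          algebraMap R (FractionRing R) (x.exponents s) = (0 : U.Index → FractionRing R) s :=
        fun s hs => by rw [ih (by omega) s hs, map_zero]; rfl
      have hmem := (magnusForm_sub n _ _ ha).2.1
      have hval := adAction_magnusForm_sub n _ _ ha s h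
      rw [magnusForm_zero] at hmem hval
      have hcom := coeff_embed_commutator (f := f) (x := x) (z := single f k 1) (by omega) hmem
        (embed_sub_one_mem _)
      rw [commutatorElement_eq_one_iff_commute.2 hx, coeff_embed_one,
        coeff_one_embed_single] at hcom
      have hz := adAction_eq_zero_of_commute_letter (sub_eq_zero.1 hcom.symm) s (by omega)
      have hz' := hval.symm.trans hz
      rw [Pi.zero_apply, sub_zero, mul_eq_zero, Nat.cast_eq_zero] at hz'
      exact (map_eq_zero_iff _ (IsFractionRing.injective R (FractionRing R))).1
        (hz'.resolve_left (by omega))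
  exact key (s.1 + 1) (val_lt_of_ne_top hs) s (Nat.lt_succ_self _)

end

end Deformation

end HallBasicSequence

namespace HallBasicSequence

open TruncSeries

variable {r c : ℕ} [NeZero c] {U V : HallBasicSequence r c}

/-! ### Central factors and powers -/

namespace Deformation

section Top

variable {R : Type*} [CommRing R] {f : Fin (U.n 0) → R → R → Fin (U.n ⊤) → R}

theorem weightOne_eq_zero_of_top [Fact (2 ≤ c)] {z : U.Deformation f}
    (hz : ∀ s : U.Index, s.1 ≠ ⊤ → z.exponents s = 0) : z.weightOne = 0 := by
  have h := weightOne_mk_add (f := f) 0 hz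
  rw [zero_add] at h
  exact h

variable [hf : Fact (∀ k, IsSymmetricTwoCocycle (f k))]

theorem twist_single (k : Fin (U.n 0)) (a b : R) (j : Fin (U.n ⊤)) :
    twist f (Pi.single k a) (Pi.single k b) ⟨⊤, j⟩ = f k a b j := by
  rw [twist_top, Finset.sum_eq_single k, Pi.single_eq_same, Pi.single_eq_same]
  · intro l _ hl
    rw [Pi.single_eq_of_ne hl, (hf.out l).zero_left]
    rfl
  · simp

variable [IsDomain R] [CharZero R] [BinomialRing R]

theorem commute_of_top (x : U.Deformation f) {z : U.Deformation f}
    (hz : ∀ s : U.Index, s.1 ≠ ⊤ → z.exponents s = 0) : Commute z x := by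
  refine embed_injective ?_
  have h : Commute z.embed x.embed := commute_of_sub_one_mem (magnusForm_sub_one_mem_of_top
    (b := fun s => algebraMap R (FractionRing R) (z.exponents s))
    fun s hs => by rw [hz s hs, map_zero]) x.embed_sub_one_mem
  rw [embed_mul, embed_mul, h.eq, twistUnit, twist_comm, ← twistUnit]

variable [hc : Fact (2 ≤ c)]

theorem weightOne_inv (x : U.Deformation f) : x⁻¹.weightOne = -x.weightOne := by
  rw [eq_neg_iff_add_eq_zero, ← weightOne_mul, inv_mul_cancel, weightOne_one]

theorem mul_of_top (x : U.Deformation f) {z : U.Deformation f}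
    (hz : ∀ s : U.Index, s.1 ≠ ⊤ → z.exponents s = 0) :
    x * z = ⟨x.exponents + z.exponents⟩ := by
  refine embed_injective ?_
  rw [embed_mk_add _ hz, embed_mul, weightOne_eq_zero_of_top hz, twistUnit, twist_comm, ← twistUnit,
    twistUnit_zero_left, mul_one]

/-- The products of the formal powers of `u_{1k}` are governed by the cocycle `f^k`. -/
theorem single_mul_single (k : Fin (U.n 0)) (a b : R) :
    single f k a * single f k b =
      single f k (a + b) * ⟨twist f (Pi.single k a) (Pi.single k b)⟩ := by
  rw [mul_of_top (single f k (a + b)) (z := ⟨twist f (Pi.single k a) (Pi.single k b)⟩)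
    (twist_of_ne _ _)]
  refine embed_injective ?_
  rw [embed_mul, ← embed_single_add, weightOne_single, weightOne_single, twistUnit,
    ← embed_mk_add _ (twist_of_ne _ _)]

theorem single_commute_single (k : Fin (U.n 0)) (a b : R) :
    Commute (single f k a) (single f k b) := by
  rw [Commute, SemiconjBy, single_mul_single, single_mul_single, add_comm, twist_comm]

/-- The criterion for `f^k` to be a coboundary: the projection of the centralizer of `u_{1k}` to
the exponents of weight one splits over the multiples of the exponent of `u_{1k}`. -/
theorem isTwoCoboundary_of_section (k : Fin (U.n 0)) (σ : R → U.Deformation f)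
    (hadd : ∀ a b, σ (a + b) = σ a * σ b) (hcomm : ∀ a, Commute (σ a) (single f k 1))
    (hσ : ∀ a, (σ a).weightOne = Pi.single k a) : IsTwoCoboundary (f k) := by
  let z (a : R) : U.Deformation f := (single f k a)⁻¹ * σ a
  have hz : ∀ a, ∀ s : U.Index, s.1 ≠ ⊤ → (z a).exponents s = 0 := fun a =>
    exponents_eq_zero_of_commute (k := k)
      ((single_commute_single k a 1).inv_left.mul_left (hcomm a)) (by
        rw [weightOne_mul, weightOne_inv, weightOne_single, hσ, neg_add_cancel])
  have hσz : ∀ a, σ a = single f k a * z a := fun a => (mul_inv_cancel_left _ _).symm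
  refine ⟨fun a j => (z a).exponents ⟨⊤, j⟩, fun a b => ?_⟩
  have h : z (a + b) = ⟨twist f (Pi.single k a) (Pi.single k b)⟩ * z a * z b := by
    refine mul_left_cancel (a := single f k (a + b)) ?_
    rw [← hσz, hadd, hσz a, hσz b, (commute_of_top _ (hz a)).mul_mul_mul_comm, single_mul_single]
    simp only [mul_assoc]
  rw [mul_of_top _ (hz a), mul_of_top _ (hz b)] at h
  ext j
  refine (congrArg (fun x : U.Deformation f => x.exponents ⟨⊤, j⟩) h).trans ?_
  change twist f _ _ ⟨⊤, j⟩ + _ + _ = _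
  rw [twist_single]
  rfl

end Top

section Power

variable {S : Type*} [CommRing S]

instance : Fact (∀ k, IsSymmetricTwoCocycle
    ((0 : Fin (U.n 0) → S → S → Fin (U.n ⊤) → S) k)) :=
  ⟨fun _ => ⟨fun _ _ _ => rfl, fun _ => rfl, fun _ => rfl, fun _ _ => rfl⟩⟩

variable [IsDomain S] [CharZero S] [BinomialRing S]

/-- Elements of `N_{r,c}(S)` have powers with exponents in `S`. -/
theorem exists_oneParameter (h : U.Deformation (0 : Fin (U.n 0) → S → S → Fin (U.n ⊤) → S)) :
    ∃ P : S → U.Deformation (0 : Fin (U.n 0) → S → S → Fin (U.n ⊤) → S),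
      P 1 = h ∧ (∀ l m, P (l + m) = P l * P m) ∧ ∀ l, (P l).weightOne = l • h.weightOne := by
  choose p hp using exists_magnusForm_eq_bpow (U := U) (algebraMap S (FractionRing S)) h.exponents
  let P (l : S) : U.Deformation (0 : Fin (U.n 0) → S → S → Fin (U.n ⊤) → S) := ⟨p l⟩
  have hP : ∀ l, (P l).embed = bpow h.embed (algebraMap S (FractionRing S) l) := hp
  refine ⟨P, embed_injective ?_, fun l m => embed_injective ?_, fun l => ?_⟩
  · rw [hP, map_one, bpow_one NeZero.one_le]
  · have ht : twist (0 : Fin (U.n 0) → S → S → Fin (U.n ⊤) → S) (P l).weightOne (P m).weightOne =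
        0 := by
      simp [twist]
    rw [embed_mul, hP, hP, hP, map_add, bpow_add h.embed_sub_one_mem, twistUnit, ht]
    exact (mul_one _).symm.trans (congrArg _ embed_one.symm)
  · have h1 := coeff_one_embed (P l)
    rw [hP, coeff_bpow_sub_one le_rfl NeZero.one_le h.embed_sub_one_mem, coeff_one_embed] at h1
    ext k
    have h2 := congrArg (fun ξ => ξ.coeff (FreeMonoid.of k)) h1
    simp only [MonoidAlgebra.coeff_smul, Finsupp.smul_apply, coeff_linearForm, smul_eq_mul] at h2
    rw [← map_mul] at h2
    exact (IsFractionRing.injective S (FractionRing S) h2).symm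

end Power

/-! ### Isomorphisms act semilinearly on the exponents of weight one -/

/-- An additive endomorphism of a free module of rank at least two that sends every vector to a
proportional one is multiplication by a scalar. -/
theorem _root_.AddMonoidHom.exists_eq_smul_of_proportional {ι S : Type*} [Finite ι] [DecidableEq ι]
    [Nontrivial ι] [CommRing S] [NoZeroDivisors S] (T : (ι → S) →+ ι → S)
    (hT : ∀ v i j, T v i * v j = T v j * v i) : ∃ s : S, ∀ v, T v = s • v := by
  have h1 : ∀ i j t, j ≠ i → T (Pi.single i t) j = 0 := by
    intro i j t hj
    by_cases ht : t = 0
    · simp [ht]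
    · have := hT (Pi.single i t) j i
      rw [Pi.single_eq_same, Pi.single_eq_of_ne hj, mul_zero, mul_eq_zero] at this
      exact this.resolve_right ht
  have h2 : ∀ i j, i ≠ j → ∀ t, T (Pi.single i t) i = T (Pi.single j 1) j * t := by
    intro i j hij t
    have := hT (Pi.single i t + Pi.single j 1) i j
    simpa [h1 i j t hij.symm, h1 j i 1 hij, Pi.single_eq_of_ne hij, Pi.single_eq_of_ne hij.symm]
      using this
  obtain ⟨k, l, hkl⟩ := exists_pair_ne ι
  have h3 : ∀ i t, T (Pi.single i t) i = T (Pi.single k 1) k * t := by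
    intro i t
    by_cases hi : i = k
    · subst hi
      rw [h2 i l hkl, h2 i l hkl 1, mul_one]
    · exact h2 i k hi t
  refine ⟨T (Pi.single k 1) k, fun v => ?_⟩
  have : T = AddMonoidHom.mulLeft (Function.const ι (T (Pi.single k 1) k)) := by
    refine AddMonoidHom.functions_ext' _ _ _ fun i => AddMonoidHom.ext fun t => funext fun j => ?_
    by_cases hj : j = i
    · subst hj
      simpa using h3 j t
    · simpa [Pi.single_eq_of_ne hj] using h1 i j t hj
  exact DFunLike.congr_fun this v

section Semilinear

variable {R : Type*} [CommRing R] [IsDomain R] [CharZero R] [BinomialRing R]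
  {f : Fin (U.n 0) → R → R → Fin (U.n ⊤) → R} [Fact (∀ k, IsSymmetricTwoCocycle (f k))]
  {S : Type*} [CommRing S] [IsDomain S] [CharZero S] [BinomialRing S]
  {g : Fin (V.n 0) → S → S → Fin (V.n ⊤) → S} [Fact (∀ k, IsSymmetricTwoCocycle (g k))]
  [hc : Fact (2 ≤ c)] (φ : U.Deformation f ≃* V.Deformation g)

theorem forall_engel_map_iff (n : ℕ) (x : U.Deformation f) :
    (∀ z, engel n (φ x) z = 1) ↔ ∀ z, engel n x z = 1 := by
  rw [φ.surjective.forall]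
  simp only [← map_engel, EmbeddingLike.map_eq_one_iff]

variable [Nontrivial (Fin (U.n 0))] [Nontrivial (Fin (V.n 0))]

theorem weightOne_map_eq_iff (x y : U.Deformation f) :
    (φ x).weightOne = (φ y).weightOne ↔ x.weightOne = y.weightOne := by
  have h := forall_engel_map_iff φ (c - 1) (x * y⁻¹)
  rwa [← weightOne_eq_zero_iff, ← weightOne_eq_zero_iff, map_mul, map_inv, weightOne_mul,
    weightOne_mul, weightOne_inv, weightOne_inv, ← sub_eq_add_neg, ← sub_eq_add_neg, sub_eq_zero,
    sub_eq_zero] at h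

theorem exists_scalar (a : R) : ∃ s : S, ∀ x y : U.Deformation f,
    x.weightOne = a • y.weightOne → (φ x).weightOne = s • (φ y).weightOne := by
  have hex : ∀ v : Fin (V.n 0) → S, ∃ x y : U.Deformation f,
      (φ y).weightOne = v ∧ x.weightOne = a • y.weightOne := by
    intro v
    obtain ⟨y', hy'⟩ := weightOne_surjective (f := g) v
    obtain ⟨y, rfl⟩ := φ.surjective y'
    obtain ⟨x, hx⟩ := weightOne_surjective (f := f) (a • y.weightOne)
    exact ⟨x, y, hy', hx⟩
  choose X Y hY hX using hex
  -- The scalar `a` acts on the exponents of weight one of the target by transport of structure.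
  have hT : ∀ x y : U.Deformation f, x.weightOne = a • y.weightOne →
      (φ (X (φ y).weightOne)).weightOne = (φ x).weightOne := by
    intro x y hxy
    rw [weightOne_map_eq_iff, hX, hxy, (weightOne_map_eq_iff φ _ _).1 (hY _)]
  let T : (Fin (V.n 0) → S) →+ Fin (V.n 0) → S := AddMonoidHom.mk' (fun v => (φ (X v)).weightOne)
    fun v w => by
      have h := hT (X v * X w) (Y v * Y w) (by
        rw [weightOne_mul, weightOne_mul, hX, hX, smul_add])
      rwa [map_mul, map_mul, weightOne_mul, weightOne_mul, hY, hY] at h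
  obtain ⟨s, hs⟩ := T.exists_eq_smul_of_proportional fun v i j => by
    have h : ∀ i j, (φ (X v)).weightOne i * (φ (Y v)).weightOne j =
        (φ (X v)).weightOne j * (φ (Y v)).weightOne i := by
      rw [weightOne_minors_iff, ← map_commutatorElement, forall_engel_map_iff,
        ← weightOne_minors_iff, hX]
      intro i j
      simp only [Pi.smul_apply, smul_eq_mul]
      ring
    rw [hY] at h
    exact h i j
  exact ⟨s, fun x y hxy => (hT x y hxy).symm.trans (hs _)⟩

end Semilinear

end Deformation

end HallBasicSequence

/-! ### Deformations isomorphic to `N_{r,c}(S)` -/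

open HallBasicSequence HallBasicSequence.Deformation

theorem mainTheorem5 {r c : ℕ} [NeZero c] (hr : 2 ≤ r) (hc : 2 ≤ c)
    {R : Type*} [CommRing R] [IsDomain R] [CharZero R] [BinomialRing R]
    {S : Type*} [CommRing S] [IsDomain S] [CharZero S] [BinomialRing S]
    (U V : HallBasicSequence r c)
    (f : Fin (U.n 0) → R → R → Fin (U.n ⊤) → R)
    (hf : ∀ k, IsSymmetricTwoCocycle (f k))
    (hiso : Nonempty (U.Deformation f ≃* V.Completion S)) :
    ∀ k, IsTwoCoboundary (f k) := by
  have := Fact.mk hc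
  have := Fact.mk hf
  have := nontrivial_weightOne (U := U) hr
  have := nontrivial_weightOne (U := V) hr
  obtain ⟨φ'⟩ := hiso
  let φ := φ'.trans completionEquiv
  intro k
  choose μ hμ using exists_scalar φ
  have hsmul : ∀ a : R, (single f k a).weightOne = a • (single f k 1).weightOne := fun a => by
    rw [weightOne_single, weightOne_single, ← Pi.single_smul, smul_eq_mul, mul_one]
  have hμ_single : ∀ a, (φ (single f k a)).weightOne = μ a • (φ (single f k 1)).weightOne :=
    fun a => hμ a _ _ (hsmul a)
  have hne : (φ (single f k 1)).weightOne ≠ 0 := fun h => by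
    have h1 := (weightOne_map_eq_iff φ (single f k 1) 1).1 (by rw [h, map_one, weightOne_one])
    rw [weightOne_single, weightOne_one] at h1
    exact one_ne_zero (Pi.single_eq_zero_iff.1 h1)
  have hμ_add : ∀ a b, μ (a + b) = μ a + μ b := fun a b => by
    have h1 := (weightOne_map_eq_iff φ (single f k (a + b)) (single f k a * single f k b)).2 (by
      rw [weightOne_mul, weightOne_single, weightOne_single, weightOne_single, Pi.single_add])
    rw [map_mul, weightOne_mul, hμ_single (a + b), hμ_single a, hμ_single b, ← add_smul] at h1
    exact smul_left_injective S hne h1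
  obtain ⟨P, hP_one, hP_add, hP⟩ := exists_oneParameter (φ (single f k 1))
  refine isTwoCoboundary_of_section k (fun a => φ.symm (P (μ a))) (fun a b => ?_) (fun a => ?_)
    fun a => ?_
  · rw [hμ_add, hP_add, map_mul]
  · have h : Commute (P (μ a)) (P 1) := by
      rw [Commute, SemiconjBy, ← hP_add, ← hP_add, add_comm]
    have h' := h.map φ.symm
    rwa [hP_one, MulEquiv.symm_apply_apply] at h'
  · rw [← weightOne_single (f := f) k a, ← weightOne_map_eq_iff φ, MulEquiv.apply_symm_apply, hP,
      hμ_single a]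

end
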